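/- Let $\mathbb{T}=\mathbb{R}/\mathbb{Z}$ and let $\mathrm{Diff}^k(\mathbb{T})$, $k\ge 1$, be the set of orientation-preserving $C^k$-diffeomorphisms of $\mathbb{T}$ (so $\phi'>0$); $\mathrm{Diff}^1(\mathbb{T})$ carries the $C^1$ topology (uniform convergence of $\phi$ and $\phi'$) and its Borel $\sigma$-algebra. For $\psi\in\mathrm{Diff}^3(\mathbb{T})$ let $\mathcal{S}_\psi=\left(\frac{\psi''}{\psi'}\right)'-\frac12\left(\frac{\psi''}{\psi'}\right)^2$ be its Schwarzian derivative. Fix $\sigma>0$ and $\alpha\in\mathbb{R}_{\ge0}\cup i\mathbb{R}_{\ge0}$, so that $\alpha^2$ is an arbitrary real number. An *unquotiented Virasoro $\alpha$-orbital measure* is a (nonnegative) Radon measure $\mu$ on $\mathrm{Diff}^1(\mathbb{T})$ such that for every $\psi\in\mathrm{Diff}^3(\mathbb{T})$ the pullback $\psi^*\mu(A)=\mu(\{\psi\circ\phi:\phi\in A\})$ is absolutely continuous with respect to $\mu$ with density $$\frac{\mathrm{d}\psi^*\mu}{\mathrm{d}\mu}(\phi)=\exp\left\{\frac{1}{\sigma^2}\int_{\mathbb{T}}\Big[\mathcal{S}_\psi(\phi(\tau))+2\alpha^2\big(\psi'(\phi(\tau))^2-1\big)\Big]\phi'(\tau)^2\,\mathrm{d}\tau\right\}.$$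 It is called *regular* if there is a real number $\beta^2$ (of either sign) such that $$\int_{\mathrm{Diff}^1(\mathbb{T})}\exp\left\{\frac{2(\beta^2-\alpha^2)}{\sigma^2}\int_{\mathbb{T}}\phi'(\tau)^2\,\mathrm{d}\tau\right\}\mathrm{d}\mu(\phi)<\infty.$$ **Theorem.** A regular unquotiented Virasoro $\alpha$-orbital measure is unique up to a multiplicative constant: if $\mu$ and $\nu$ are regular unquotiented Virasoro $\alpha$-orbital measures (for the same $\sigma$ and $\alpha$) and $\mu\neq0$, then $\nu=c\,\mu$ for some constant $c\in[0,\infty)$. As a consequence, every regular unquotiented Virasoro $\alpha$-orbital measure $\mu$ is translation-invariant: for every $\tau_0\in\mathbb{T}$ it is preserved by the map $\phi(\cdot)\mapsto\phi(\cdot+\tau_0)$. -/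

import Mathlib

open MeasureTheory
open scoped NNReal ENNReal

noncomputable section

/-- `F` is a `C^k` lift to `ℝ` of the self-map `φ` of the circle `𝕋 = ℝ/ℤ`, of degree one and with
positive derivative. -/
structure IsCircleLift (k : ℕ) (φ : UnitAddCircle → UnitAddCircle) (F : ℝ → ℝ) : Prop where
  contDiff : ContDiff ℝ k F
  deriv_pos : ∀ x, 0 < deriv F x
  map_add_one : ∀ x, F (x + 1) = F x + 1
  coe_eq : ∀ x : ℝ, φ (x : UnitAddCircle) = (F x : UnitAddCircle)

/-- `Diff^k(𝕋)`, for `k ≥ 1`: the orientation-preserving `C^k`-diffeomorphisms of the circle, that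
is, the homeomorphisms that are `C^k` with positive derivative in the angular coordinate
(the inverse is then `C^k` by the inverse function theorem). -/
structure CircleDiffeo (k : ℕ) where
  toHomeomorph : UnitAddCircle ≃ₜ UnitAddCircle
  exists_lift : ∃ F : ℝ → ℝ, IsCircleLift k toHomeomorph F

/-- The Schwarzian derivative `(F''/F')' - (F''/F')²/2` of a function of a real variable. -/
def realSchwarzian (F : ℝ → ℝ) (x : ℝ) : ℝ :=
  deriv (fun y => deriv (deriv F) y / deriv F y) x - (deriv (deriv F) x / deriv F x) ^ 2 / 2

theorem IsCircleLift.periodic_deriv {k : ℕ} {φ : UnitAddCircle → UnitAddCircle} {F : ℝ → ℝ}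
    (h : IsCircleLift k φ F) : Function.Periodic (deriv F) 1 := by
  intro x
  rw [← deriv_comp_add_const, show (fun y => F (y + 1)) = fun y => F y + 1 from
    funext h.map_add_one, deriv_add_const]

theorem IsCircleLift.periodic_schwarzian {k : ℕ} {φ : UnitAddCircle → UnitAddCircle} {F : ℝ → ℝ}
    (h : IsCircleLift k φ F) : Function.Periodic (realSchwarzian F) 1 := by
  have h1 : ∀ x, deriv F (x + 1) = deriv F x := h.periodic_deriv
  have h2 : ∀ x, deriv (deriv F) (x + 1) = deriv (deriv F) x := by
    intro x
    rw [← deriv_comp_add_const, show (fun y => deriv F (y + 1)) = deriv F from funext h1]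
  intro x
  unfold realSchwarzian
  rw [← deriv_comp_add_const]
  simp only [h1, h2]

/-- Any two lifts differ by an integer constant, so that the derivative and the Schwarzian
derivative below do not depend on the lift. -/
theorem IsCircleLift.unique {k : ℕ} {φ : UnitAddCircle → UnitAddCircle} {F G : ℝ → ℝ}
    (hF : IsCircleLift k φ F) (hG : IsCircleLift k φ G) : ∃ n : ℤ, ∀ x, F x = G x + n := by
  have hex : ∀ x, ∃ n : ℤ, (n : ℝ) = F x - G x := by
    intro x
    have h : ((F x - G x : ℝ) : UnitAddCircle) = 0 := by
      rw [AddCircle.coe_sub, ← hF.coe_eq, ← hG.coe_eq, sub_self]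
    obtain ⟨n, hn⟩ := (AddCircle.coe_eq_zero_iff (1 : ℝ)).1 h
    exact ⟨n, by simpa using hn⟩
  choose n hn using hex
  have hc : Continuous fun x => (n x : ℝ) := by
    simp only [hn]
    exact hF.contDiff.continuous.sub hG.contDiff.continuous
  have hc' : Continuous n := Int.isClosedEmbedding_coe_real.isEmbedding.continuous_iff.2 hc
  refine ⟨n 0, fun x => ?_⟩
  have h0 : n x = n 0 := PreconnectedSpace.constant inferInstance hc'
  have := hn x
  rw [h0] at this
  linarith

theorem IsCircleLift.deriv_eq {k : ℕ} {φ : UnitAddCircle → UnitAddCircle} {F G : ℝ → ℝ}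
    (hF : IsCircleLift k φ F) (hG : IsCircleLift k φ G) : deriv F = deriv G := by
  obtain ⟨n, hn⟩ := hF.unique hG
  rw [show F = fun x => G x + n from funext hn]
  exact funext fun x => deriv_add_const _

theorem IsCircleLift.schwarzian_eq {k : ℕ} {φ : UnitAddCircle → UnitAddCircle} {F G : ℝ → ℝ}
    (hF : IsCircleLift k φ F) (hG : IsCircleLift k φ G) :
    realSchwarzian F = realSchwarzian G := by
  unfold realSchwarzian
  rw [hF.deriv_eq hG]

namespace CircleDiffeo

variable {k : ℕ}

instance : CoeFun (CircleDiffeo k) fun _ => UnitAddCircle → UnitAddCircle :=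
  ⟨fun φ => φ.toHomeomorph⟩

/-- A lift of `φ`. -/
def lift (φ : CircleDiffeo k) : ℝ → ℝ := φ.exists_lift.choose

theorem isCircleLift_lift (φ : CircleDiffeo k) : IsCircleLift k φ φ.lift :=
  φ.exists_lift.choose_spec

/-- The derivative `φ' : 𝕋 → ℝ`. -/
def derivative (φ : CircleDiffeo k) : UnitAddCircle → ℝ :=
  φ.isCircleLift_lift.periodic_deriv.lift

/-- The Schwarzian derivative `S_φ : 𝕋 → ℝ` (for `k ≥ 3`). -/
def schwarzian (φ : CircleDiffeo k) : UnitAddCircle → ℝ :=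
  φ.isCircleLift_lift.periodic_schwarzian.lift

theorem continuous_derivative (φ : CircleDiffeo 1) : Continuous φ.derivative := by
  have h : Continuous (deriv φ.lift) :=
    φ.isCircleLift_lift.contDiff.continuous_deriv (by norm_num)
  exact continuous_quot_lift _ h

/-- `φ ↦ (φ, φ')`. -/
def jet (φ : CircleDiffeo 1) : C(UnitAddCircle, UnitAddCircle) × C(UnitAddCircle, ℝ) :=
  (⟨φ, φ.toHomeomorph.continuous⟩, ⟨φ.derivative, φ.continuous_derivative⟩)

/-- The `C¹` topology: uniform convergence of `φ` and of `φ'`. -/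
instance : TopologicalSpace (CircleDiffeo 1) := TopologicalSpace.induced jet inferInstance

instance : MeasurableSpace (CircleDiffeo 1) := borel _

instance : BorelSpace (CircleDiffeo 1) := ⟨rfl⟩

/-- Composition `ψ ∘ φ`, for `ψ` at least as smooth as `φ`. -/
def comp {l : ℕ} (hlk : k ≤ l) (ψ : CircleDiffeo l) (φ : CircleDiffeo k) : CircleDiffeo k where
  toHomeomorph := φ.toHomeomorph.trans ψ.toHomeomorph
  exists_lift := by
    obtain ⟨F, hF⟩ := φ.exists_lift
    obtain ⟨G, hG⟩ := ψ.exists_lift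
    refine ⟨G ∘ F, (hG.contDiff.of_le (by exact_mod_cast hlk)).comp hF.contDiff, ?_, ?_, ?_⟩
    · intro x
      have h1 : DifferentiableAt ℝ F x := differentiableAt_of_deriv_ne_zero (hF.deriv_pos x).ne'
      have h2 : DifferentiableAt ℝ G (F x) :=
        differentiableAt_of_deriv_ne_zero (hG.deriv_pos (F x)).ne'
      rw [deriv_comp x h2 h1]
      exact mul_pos (hG.deriv_pos _) (hF.deriv_pos _)
    · intro x
      simp only [Function.comp_apply, hF.map_add_one, hG.map_add_one]
    · intro x
      simp only [Homeomorph.trans_apply, Function.comp_apply, hF.coe_eq, hG.coe_eq]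

/-- The rotation `τ ↦ τ + τ₀`. -/
def rotation (k : ℕ) (τ₀ : UnitAddCircle) : CircleDiffeo k where
  toHomeomorph := Homeomorph.addRight τ₀
  exists_lift := by
    obtain ⟨t, rfl⟩ := QuotientAddGroup.mk_surjective τ₀
    refine ⟨fun x => x + t, by fun_prop, ?_, ?_, ?_⟩
    · intro x
      simp
    · intro x
      ring
    · intro x
      simp

/-- The translate `φ(· + τ₀)`. -/
def translate (τ₀ : UnitAddCircle) (φ : CircleDiffeo 1) : CircleDiffeo 1 :=
  φ.comp le_rfl (rotation 1 τ₀)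

/-- Post-composition `φ ↦ ψ ∘ φ` of `Diff¹(𝕋)` with `ψ ∈ Diff³(𝕋)`. -/
def postcomp (ψ : CircleDiffeo 3) (φ : CircleDiffeo 1) : CircleDiffeo 1 :=
  ψ.comp (by norm_num) φ

/-- `∫_𝕋 φ'(τ)² dτ`. -/
def energy (φ : CircleDiffeo 1) : ℝ := ∫ τ : UnitAddCircle, φ.derivative τ ^ 2

end CircleDiffeo

/-- A Radon measure: locally finite, and inner regular for compact sets on Borel sets. -/
structure IsRadonMeasure {X : Type*} [TopologicalSpace X] [MeasurableSpace X]
    (μ : Measure X) : Prop where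
  locallyFinite : IsLocallyFiniteMeasure μ
  innerRegular : μ.InnerRegular

/-- The density
`exp (σ⁻² ∫_𝕋 [S_ψ(φ(τ)) + 2 α² (ψ'(φ(τ))² - 1)] φ'(τ)² dτ)`; the real parameter `αsq` is `α²`. -/
def orbitalDensity (σ αsq : ℝ) (ψ : CircleDiffeo 3) (φ : CircleDiffeo 1) : ℝ :=
  Real.exp (1 / σ ^ 2 * ∫ τ : UnitAddCircle,
    (ψ.schwarzian (φ τ) + 2 * αsq * (ψ.derivative (φ τ) ^ 2 - 1)) * φ.derivative τ ^ 2)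

/-- Unquotiented Virasoro `α`-orbital measures with parameter `σ²`, where `αsq = α²`: Radon measures
`μ` on `Diff¹(𝕋)` such that for all `ψ ∈ Diff³(𝕋)` the pullback `ψ^*μ(A) = μ(ψ ∘ A)` has density
`orbitalDensity σ αsq ψ` with respect to `μ`. -/
structure IsOrbitalMeasure (σ αsq : ℝ) (μ : Measure (CircleDiffeo 1)) : Prop where
  radon : IsRadonMeasure μ
  change_of_variables : ∀ (ψ : CircleDiffeo 3) (A : Set (CircleDiffeo 1)), MeasurableSet A →
    μ (ψ.postcomp '' A) = ∫⁻ φ in A, ENNReal.ofReal (orbitalDensity σ αsq ψ φ) ∂μ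

/-- The reweighted measure `exp (2 (β² - α²) σ⁻² ∫_𝕋 φ'²) dμ(φ)`, where `αsq = α²`, `βsq = β²`. -/
def reweight (σ αsq βsq : ℝ) (μ : Measure (CircleDiffeo 1)) : Measure (CircleDiffeo 1) :=
  μ.withDensity fun φ => ENNReal.ofReal (Real.exp (2 * (βsq - αsq) / σ ^ 2 * φ.energy))

/-- An orbital measure is regular if one of its reweightings has finite total mass. -/
structure IsRegularOrbitalMeasure (σ αsq : ℝ) (μ : Measure (CircleDiffeo 1)) : Prop where
  orbital : IsOrbitalMeasure σ αsq μ
  exists_finite : ∃ βsq : ℝ, reweight σ αsq βsq μ Set.univ < ∞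

end

noncomputable section

/-! ### Circle diffeomorphisms and their lifts -/

/-! Write `q(u) = φ'(φ⁻¹(u))` for the speed of `φ` as a function of its value. Substituting `u =
φ(τ)`, the exponent of the density becomes linear in `q`, and its `α`-part is a difference of
energies `∫ q`. Reweighting by the energy therefore removes `α` and leaves a measure `m` with the
pure Schwarzian cocycle. Put `s = 2/σ²` and study `L(g, w) = ∫ g(φ⁻¹(0)) exp(-s ∫ w q) dm`. The pair
(root `φ⁻¹(0)`, speed `q`) determines `φ`, so it is enough to compute `L` up to one constant.

Reduction to constants. If `w = r' + r²` with `r` periodic of mean `β > 0`, the ratio of the two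
Floquet solutions of `y'' = w y` gives a diffeomorphism `ψ` fixing `0` with `w = β² ψ'² - S_ψ/2`.
Quasi-invariance under `ψ` yields `L(g, w) = L(g, β²)`
(`SchwarzianQuasiInvariant.laplaceFunctional_riccati`). Every continuous periodic `w ≥ b² > 0` has
this form (`exists_riccati`).

The constants. Apply the reduction to approximations of `b² + c δ₀`; in the limit `cosh β = cosh b +
c sinh b / (2b)`. Integrating over all `c > 0` replaces `exp(-s c q(0))` by `1 / (s q(0))`. Rotation
invariance averages the evaluation point over the circle, and a change of variables cancels `1/q`.
The result is the renewal identity `∫_b^∞ sinh β L(g, β²) dβ = sinh b / (2 s b) · ∫ g · L(1, b²)`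
(`lintegral_sinh_mul_laplaceFunctional`). Differentiating it in `b` gives a linear differential
equation, whose solution is `L(g, b²) = C ∫ g · b exp(-s b²) / sinh b`
(`exists_laplaceFunctional_const_eq`).

Hence two regular measures have proportional Laplace functionals, and are proportional by
`eq_of_laplaceFunctional_withDensity_eq`. Translation fixes `q`, shifts the root and does not change
`∫ g`, which gives invariance. -/

theorem IsCircleLift.hasDerivAt {k : ℕ} {φ : UnitAddCircle → UnitAddCircle} {F : ℝ → ℝ}
    (h : IsCircleLift k φ F) (x : ℝ) : HasDerivAt F (deriv F x) x :=
  (differentiableAt_of_deriv_ne_zero (h.deriv_pos x).ne').hasDerivAt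

theorem map_add_int_of_map_add_one {F : ℝ → ℝ} (h : ∀ x, F (x + 1) = F x + 1) (x : ℝ) (n : ℤ) :
    F (x + n) = F x + n := by
  have hp : Function.Periodic (fun x => F x - x) 1 := fun x => by
    simp only [h]; ring
  have := hp.int_mul n x
  simp only [mul_one] at this
  linarith

theorem surjective_of_map_add_one {F : ℝ → ℝ} (hc : Continuous F)
    (h : ∀ x, F (x + 1) = F x + 1) : Function.Surjective F := by
  intro y
  have h1 : F ((⌊y - F 0⌋ : ℤ) : ℝ) ≤ y := by
    have := map_add_int_of_map_add_one h 0 ⌊y - F 0⌋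
    rw [zero_add] at this
    have := Int.floor_le (y - F 0)
    linarith
  have h2 : y ≤ F ((⌊y - F 0⌋ + 1 : ℤ) : ℝ) := by
    have := map_add_int_of_map_add_one h 0 (⌊y - F 0⌋ + 1)
    rw [zero_add] at this
    have h3 := Int.lt_floor_add_one (y - F 0)
    push_cast at this ⊢
    linarith
  exact mem_range_of_exists_le_of_exists_ge hc ⟨_, h1⟩ ⟨_, h2⟩

/-- The circle homeomorphism with a given strictly increasing lift of degree one. -/
def circleHomeomorphOfLift (F : ℝ → ℝ) (hc : Continuous F) (hm : StrictMono F)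
    (h : ∀ x, F (x + 1) = F x + 1) : UnitAddCircle ≃ₜ UnitAddCircle :=
  have hp : Function.Periodic (fun x => (F x : UnitAddCircle)) 1 := fun x => by
    simp only [h, AddCircle.coe_add, AddCircle.coe_period, add_zero]
  have hcont : Continuous hp.lift :=
    continuous_quot_lift _ ((AddCircle.continuous_mk' 1).comp hc)
  have hinj : Function.Injective hp.lift := by
    intro a b hab
    obtain ⟨x, rfl⟩ := QuotientAddGroup.mk_surjective a
    obtain ⟨y, rfl⟩ := QuotientAddGroup.mk_surjective b
    have h0 : ((F x - F y : ℝ) : UnitAddCircle) = 0 := by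
      rw [AddCircle.coe_sub, sub_eq_zero]; exact hab
    obtain ⟨n, hn⟩ := (AddCircle.coe_eq_zero_iff (1 : ℝ)).1 h0
    have h1 : F x = F (y + n) := by
      rw [map_add_int_of_map_add_one h]
      have : (n : ℝ) = F x - F y := by simpa using hn
      linarith
    have h2 : x = y + n := hm.injective h1
    have h3 : ((n : ℝ) : UnitAddCircle) = 0 :=
      (AddCircle.coe_eq_zero_iff (1 : ℝ)).2 ⟨n, by simp⟩
    change ((x : ℝ) : UnitAddCircle) = (y : ℝ)
    rw [h2, AddCircle.coe_add, h3, add_zero]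
  have hsurj : Function.Surjective hp.lift := by
    intro b
    obtain ⟨y, rfl⟩ := QuotientAddGroup.mk_surjective b
    obtain ⟨x, rfl⟩ := surjective_of_map_add_one hc h y
    exact ⟨(x : UnitAddCircle), rfl⟩
  Continuous.homeoOfEquivCompactToT2 (f := Equiv.ofBijective hp.lift ⟨hinj, hsurj⟩) hcont

theorem CircleDiffeo.exists_of_lift {k : ℕ} (F : ℝ → ℝ) (hF : ContDiff ℝ k F)
    (hd : ∀ x, 0 < deriv F x) (h : ∀ x, F (x + 1) = F x + 1) :
    ∃ ψ : CircleDiffeo k, IsCircleLift k ψ F :=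
  have hl : IsCircleLift k (circleHomeomorphOfLift F hF.continuous
      (strictMono_of_deriv_pos hd) h) F := ⟨hF, hd, h, fun _ => rfl⟩
  ⟨⟨circleHomeomorphOfLift F hF.continuous (strictMono_of_deriv_pos hd) h, F, hl⟩, hl⟩

namespace CircleDiffeo

variable {k : ℕ}

theorem ext_fun {φ ψ : CircleDiffeo k} (h : ∀ τ, φ τ = ψ τ) : φ = ψ := by
  cases φ; cases ψ
  congr
  exact Homeomorph.ext h

theorem derivative_coe {φ : CircleDiffeo k} {F : ℝ → ℝ} (hF : IsCircleLift k φ F) (x : ℝ) :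
    φ.derivative (x : UnitAddCircle) = deriv F x := by
  rw [hF.deriv_eq φ.isCircleLift_lift]
  rfl

theorem schwarzian_coe {φ : CircleDiffeo k} {F : ℝ → ℝ} (hF : IsCircleLift k φ F) (x : ℝ) :
    φ.schwarzian (x : UnitAddCircle) = realSchwarzian F x := by
  rw [hF.schwarzian_eq φ.isCircleLift_lift]
  rfl

theorem derivative_pos (φ : CircleDiffeo k) (τ : UnitAddCircle) : 0 < φ.derivative τ := by
  obtain ⟨x, rfl⟩ := QuotientAddGroup.mk_surjective τ
  exact φ.isCircleLift_lift.deriv_pos x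

theorem continuous_derivative_of_one_le (hk : 1 ≤ k) (φ : CircleDiffeo k) :
    Continuous φ.derivative := by
  have h : Continuous (deriv φ.lift) :=
    φ.isCircleLift_lift.contDiff.continuous_deriv (by exact_mod_cast hk)
  exact continuous_quot_lift _ h

theorem isCircleLift_comp {l : ℕ} (hlk : k ≤ l) {ψ : CircleDiffeo l} {φ : CircleDiffeo k}
    {F G : ℝ → ℝ} (hG : IsCircleLift l ψ G) (hF : IsCircleLift k φ F) :
    IsCircleLift k (ψ.comp hlk φ) (G ∘ F) where
  contDiff := (hG.contDiff.of_le (by exact_mod_cast hlk)).comp hF.contDiff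
  deriv_pos x := by
    rw [((hG.hasDerivAt (F x)).comp x (hF.hasDerivAt x)).deriv]
    exact mul_pos (hG.deriv_pos _) (hF.deriv_pos _)
  map_add_one x := by simp only [Function.comp_apply, hF.map_add_one, hG.map_add_one]
  coe_eq x := by
    change ψ (φ x) = _
    rw [hF.coe_eq, hG.coe_eq]; rfl

theorem derivative_comp {l : ℕ} (hlk : k ≤ l) (ψ : CircleDiffeo l) (φ : CircleDiffeo k)
    (τ : UnitAddCircle) :
    (ψ.comp hlk φ).derivative τ = ψ.derivative (φ τ) * φ.derivative τ := by
  obtain ⟨x, rfl⟩ := QuotientAddGroup.mk_surjective τ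
  have hG := ψ.isCircleLift_lift
  have hF := φ.isCircleLift_lift
  change (ψ.comp hlk φ).derivative ((x : ℝ) : UnitAddCircle)
    = ψ.derivative (φ (x : ℝ)) * φ.derivative ((x : ℝ) : UnitAddCircle)
  rw [derivative_coe (isCircleLift_comp hlk hG hF), derivative_coe hF, hF.coe_eq,
    derivative_coe hG, ((hG.hasDerivAt _).comp x (hF.hasDerivAt x)).deriv]

theorem exists_inverse (ψ : CircleDiffeo k) :
    ∃ χ : CircleDiffeo k, χ.toHomeomorph = ψ.toHomeomorph.symm := by
  have hF := ψ.isCircleLift_lift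
  set F := ψ.lift
  have hm : StrictMono F := strictMono_of_deriv_pos hF.deriv_pos
  have hs := surjective_of_map_add_one hF.contDiff.continuous hF.map_add_one
  let e : ℝ ≃ₜ ℝ := (hm.orderIsoOfSurjective F hs).toHomeomorph
  have he : ∀ x, e x = F x := fun x => rfl
  have hes : ∀ x, F (e.symm x) = x := fun x => e.apply_symm_apply x
  have hd : ∀ y, HasDerivAt e.symm (deriv F (e.symm y))⁻¹ y := fun y =>
    HasDerivAt.of_local_left_inverse e.symm.continuous.continuousAt
      (hF.hasDerivAt (e.symm y)) (hF.deriv_pos _).ne' (Filter.Eventually.of_forall hes)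
  refine ⟨⟨ψ.toHomeomorph.symm, e.symm, ?_, ?_, ?_, ?_⟩, rfl⟩
  · exact e.contDiff_symm_deriv (f' := deriv F) (fun x => (hF.deriv_pos x).ne')
      (fun x => hF.hasDerivAt x) hF.contDiff
  · intro y
    rw [(hd y).deriv]
    exact inv_pos.2 (hF.deriv_pos _)
  · intro y
    apply hm.injective
    rw [hes, hF.map_add_one, hes]
  · intro y
    rw [Homeomorph.symm_apply_eq, hF.coe_eq, hes]

/-- Every Borel set is then the image under `ψ` of its preimage, which turns the formula for `μ(ψ ∘
A)` into an identity between `μ` and a pushforward. -/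
theorem postcomp_surjective (ψ : CircleDiffeo 3) : Function.Surjective ψ.postcomp := by
  obtain ⟨χ, hχ⟩ := exists_inverse ψ
  intro φ
  refine ⟨χ.postcomp φ, ext_fun fun τ => ?_⟩
  change ψ.toHomeomorph (χ.toHomeomorph (φ τ)) = φ τ
  rw [hχ]
  simp

/-! ### Continuity in the `C¹` topology -/

theorem continuous_jet : Continuous jet := continuous_induced_dom

theorem continuous_eval : Continuous fun p : CircleDiffeo 1 × UnitAddCircle => p.1 p.2 := by
  have h : Continuous fun p : CircleDiffeo 1 × UnitAddCircle => (jet p.1).1 p.2 :=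
    (continuous_fst.comp (continuous_jet.comp continuous_fst)).eval continuous_snd
  exact h

theorem continuous_derivative_eval :
    Continuous fun p : CircleDiffeo 1 × UnitAddCircle => p.1.derivative p.2 := by
  have h : Continuous fun p : CircleDiffeo 1 × UnitAddCircle => (jet p.1).2 p.2 :=
    (continuous_snd.comp (continuous_jet.comp continuous_fst)).eval continuous_snd
  exact h

/-- The graph relation is closed and projection along the compact circle is a closed map, so
preimages of closed sets are closed. No quantitative control of the inverse is needed. -/
theorem continuous_symm_eval :
    Continuous fun p : CircleDiffeo 1 × UnitAddCircle => p.1.toHomeomorph.symm p.2 := by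
  refine continuous_iff_isClosed.2 fun C hC => ?_
  have h1 : IsClosed {p : (CircleDiffeo 1 × UnitAddCircle) × UnitAddCircle |
      p.1.1 p.2 = p.1.2 ∧ p.2 ∈ C} := by
    refine IsClosed.inter (isClosed_eq ?_ ?_) (hC.preimage continuous_snd)
    · exact continuous_eval.comp
        ((continuous_fst.comp continuous_fst).prodMk continuous_snd)
    · exact continuous_snd.comp continuous_fst
  convert! isClosedMap_fst_of_compactSpace _ h1 using 1
  ext p
  simp only [Set.mem_preimage, Set.mem_image, Set.mem_ofPred_eq]
  constructor
  · intro hp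
    exact ⟨(p, p.1.toHomeomorph.symm p.2), ⟨p.1.toHomeomorph.apply_symm_apply _, hp⟩, rfl⟩
  · rintro ⟨⟨p', τ⟩, ⟨h, hτ⟩, rfl⟩
    rw [← (p'.1.toHomeomorph.symm_apply_eq).2 (h : p'.1.toHomeomorph τ = p'.2).symm] at hτ
    exact hτ

theorem continuous_of_continuous_eval {X : Type*} [TopologicalSpace X] {f : X → CircleDiffeo 1}
    (h1 : Continuous fun p : X × UnitAddCircle => f p.1 p.2)
    (h2 : Continuous fun p : X × UnitAddCircle => (f p.1).derivative p.2) : Continuous f := by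
  refine continuous_induced_rng.2 (Continuous.prodMk ?_ ?_)
  · exact ContinuousMap.continuous_of_continuous_uncurry _ h1
  · exact ContinuousMap.continuous_of_continuous_uncurry _ h2

theorem continuous_postcomp (ψ : CircleDiffeo 3) : Continuous ψ.postcomp := by
  refine continuous_of_continuous_eval ?_ ?_
  · exact ψ.toHomeomorph.continuous.comp continuous_eval
  · have h : Continuous fun p : CircleDiffeo 1 × UnitAddCircle =>
        ψ.derivative (p.1 p.2) * p.1.derivative p.2 :=
      ((continuous_derivative_of_one_le (by norm_num) ψ).comp continuous_eval).mul
        continuous_derivative_eval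
    convert! h using 2 with p
    exact derivative_comp _ ψ p.1 p.2

/-! ### Rotations and translations -/

theorem derivative_rotation (τ₀ τ : UnitAddCircle) : (rotation k τ₀).derivative τ = 1 := by
  obtain ⟨t, rfl⟩ := QuotientAddGroup.mk_surjective τ₀
  obtain ⟨x, rfl⟩ := QuotientAddGroup.mk_surjective τ
  have hl : IsCircleLift k (rotation k (t : UnitAddCircle)) fun x => x + t :=
    ⟨by fun_prop, fun x => by simp, fun x => by ring, fun x => by
      change ((x : ℝ) : UnitAddCircle) + (t : UnitAddCircle) = _
      rw [AddCircle.coe_add]⟩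
  exact (derivative_coe hl x).trans (by simp)

theorem schwarzian_rotation (τ₀ τ : UnitAddCircle) : (rotation k τ₀).schwarzian τ = 0 := by
  obtain ⟨t, rfl⟩ := QuotientAddGroup.mk_surjective τ₀
  obtain ⟨x, rfl⟩ := QuotientAddGroup.mk_surjective τ
  have hl : IsCircleLift k (rotation k (t : UnitAddCircle)) fun x => x + t :=
    ⟨by fun_prop, fun x => by simp, fun x => by ring, fun x => by
      change ((x : ℝ) : UnitAddCircle) + (t : UnitAddCircle) = _
      rw [AddCircle.coe_add]⟩
  refine (schwarzian_coe hl x).trans ?_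
  have : deriv (fun x : ℝ => x + t) = fun _ => 1 := by ext; simp
  simp [realSchwarzian, this]

theorem derivative_translate (τ₀ : UnitAddCircle) (φ : CircleDiffeo 1) (τ : UnitAddCircle) :
    (translate τ₀ φ).derivative τ = φ.derivative (τ + τ₀) := by
  rw [translate, derivative_comp, derivative_rotation, mul_one]
  rfl

theorem continuous_translate (τ₀ : UnitAddCircle) : Continuous (translate τ₀) := by
  refine continuous_of_continuous_eval ?_ ?_
  · exact continuous_eval.comp
      (continuous_fst.prodMk (continuous_snd.add continuous_const))
  · simp only [derivative_translate]
    exact continuous_derivative_eval.comp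
      (continuous_fst.prodMk (continuous_snd.add continuous_const))

/-! ### The speed of a diffeomorphism as a function of its value -/

/-- The function `u ↦ φ'(φ⁻¹(u))`. -/
def speed (φ : CircleDiffeo 1) : C(UnitAddCircle, ℝ≥0) where
  toFun u := ⟨φ.derivative (φ.toHomeomorph.symm u), (φ.derivative_pos _).le⟩
  continuous_toFun := Continuous.subtype_mk
    (φ.continuous_derivative.comp φ.toHomeomorph.symm.continuous) _

theorem coe_speed (φ : CircleDiffeo 1) (u : UnitAddCircle) :
    (φ.speed u : ℝ) = φ.derivative (φ.toHomeomorph.symm u) := rfl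

theorem speed_pos (φ : CircleDiffeo 1) (u : UnitAddCircle) : 0 < (φ.speed u : ℝ) :=
  φ.derivative_pos _

theorem coe_speed_apply (φ : CircleDiffeo 1) (τ : UnitAddCircle) :
    (φ.speed (φ τ) : ℝ) = φ.derivative τ := by
  rw [coe_speed, Homeomorph.symm_apply_apply]

theorem continuous_speed_eval :
    Continuous fun p : CircleDiffeo 1 × UnitAddCircle => p.1.speed p.2 :=
  Continuous.subtype_mk
    (continuous_derivative_eval.comp (continuous_fst.prodMk continuous_symm_eval)) _

theorem continuous_speed : Continuous speed :=
  ContinuousMap.continuous_of_continuous_uncurry _ continuous_speed_eval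

theorem integral_comp_mul_derivative (φ : CircleDiffeo 1) {f : UnitAddCircle → ℝ}
    (hf : Continuous f) : ∫ τ, f (φ τ) * φ.derivative τ = ∫ u, f u := by
  have hF := φ.isCircleLift_lift
  set F := φ.lift
  rw [← UnitAddCircle.intervalIntegral_preimage 0, ← UnitAddCircle.intervalIntegral_preimage (F 0)]
  have h1 : ∀ x : ℝ, f (φ (x : UnitAddCircle)) * φ.derivative (x : UnitAddCircle)
      = ((fun y : ℝ => f (y : UnitAddCircle)) ∘ F) x * deriv F x := fun x => by
    rw [derivative_coe hF, hF.coe_eq]; rfl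
  simp only [h1]
  have hg : Continuous fun y : ℝ => f (y : UnitAddCircle) := hf.comp (AddCircle.continuous_mk' 1)
  rw [intervalIntegral.integral_comp_mul_deriv (fun x _ => hF.hasDerivAt x)
    (hF.contDiff.continuous_deriv (by norm_num)).continuousOn hg, hF.map_add_one]

/-- The substitution `u = φ(τ)` uses up one factor `φ'`. All exponents quadratic in `φ'` become
linear in the speed, hence accessible to a Laplace transform. -/
theorem integral_mul_speed (φ : CircleDiffeo 1) {w : UnitAddCircle → ℝ} (hw : Continuous w) :
    ∫ u, w u * φ.speed u = ∫ τ, w (φ τ) * φ.derivative τ ^ 2 := by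
  have hc : Continuous fun u => w u * (φ.speed u : ℝ) :=
    hw.mul (NNReal.continuous_coe.comp φ.speed.continuous)
  rw [← φ.integral_comp_mul_derivative hc]
  refine integral_congr_ae (Filter.Eventually.of_forall fun τ => ?_)
  simp only [coe_speed_apply]
  ring

theorem energy_eq (φ : CircleDiffeo 1) : φ.energy = ∫ u, (φ.speed u : ℝ) := by
  have := φ.integral_mul_speed (w := fun _ => 1) continuous_const
  simpa [energy] using this.symm

/-- The substitution `u = φ(τ)` cancels the speed. The answer no longer depends on `φ`, which is
what closes the renewal identity. -/
theorem integral_symm_div_speed (φ : CircleDiffeo 1) {g : UnitAddCircle → ℝ} (hg : Continuous g) :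
    ∫ u, g (φ.toHomeomorph.symm u) / φ.speed u = ∫ τ, g τ := by
  have hc : Continuous fun u => g (φ.toHomeomorph.symm u) / (φ.speed u : ℝ) :=
    (hg.comp φ.toHomeomorph.symm.continuous).div₀
      (NNReal.continuous_coe.comp φ.speed.continuous) fun u => (φ.speed_pos u).ne'
  rw [← φ.integral_comp_mul_derivative hc]
  refine integral_congr_ae (Filter.Eventually.of_forall fun τ => ?_)
  simp only [coe_speed_apply, Homeomorph.symm_apply_apply]
  field_simp [(φ.derivative_pos τ).ne']

theorem symm_translate (τ₀ : UnitAddCircle) (φ : CircleDiffeo 1) (u : UnitAddCircle) :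
    (translate τ₀ φ).toHomeomorph.symm u = φ.toHomeomorph.symm u - τ₀ := by
  rw [Homeomorph.symm_apply_eq]
  change u = φ.toHomeomorph (φ.toHomeomorph.symm u - τ₀ + τ₀)
  simp

/-- The speed is indexed by the value of `φ`, not by time, so translating time moves only the root.
-/
theorem speed_translate (τ₀ : UnitAddCircle) (φ : CircleDiffeo 1) :
    (translate τ₀ φ).speed = φ.speed := by
  ext u
  rw [coe_speed, coe_speed, derivative_translate, symm_translate, sub_add_cancel]

theorem symm_postcomp (ψ : CircleDiffeo 3) (φ : CircleDiffeo 1) (u : UnitAddCircle) :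
    (ψ.postcomp φ).toHomeomorph.symm u = φ.toHomeomorph.symm (ψ.toHomeomorph.symm u) := rfl

theorem energy_postcomp (ψ : CircleDiffeo 3) (φ : CircleDiffeo 1) :
    (ψ.postcomp φ).energy = ∫ u, ψ.derivative u ^ 2 * φ.speed u := by
  rw [φ.integral_mul_speed (w := fun u => ψ.derivative u ^ 2)
    ((continuous_derivative_of_one_le (by norm_num) ψ).pow 2)]
  simp only [energy, postcomp, derivative_comp, mul_pow]

/-- The root and the speed determine a diffeomorphism. -/
theorem eq_of_symm_zero_eq_of_speed_eq {φ₁ φ₂ : CircleDiffeo 1}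
    (h0 : φ₁.toHomeomorph.symm 0 = φ₂.toHomeomorph.symm 0) (hs : φ₁.speed = φ₂.speed) :
    φ₁ = φ₂ := by
  obtain ⟨χ₁, hχ₁⟩ := exists_inverse φ₁
  obtain ⟨χ₂, hχ₂⟩ := exists_inverse φ₂
  -- The inverse has derivative `1 / speed`, so equal speeds give inverses whose lifts differ by a
  -- constant; equal roots make that constant an integer.
  have key : ∀ (φ χ : CircleDiffeo 1), χ.toHomeomorph = φ.toHomeomorph.symm →
      ∀ u, χ.derivative u = (φ.speed u : ℝ)⁻¹ := by
    intro φ χ hχ u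
    have h1 : (φ.comp le_rfl χ).derivative u = 1 := by
      rw [← derivative_rotation (k := 1) 0 u]
      congr 1
      refine ext_fun fun τ => ?_
      change φ.toHomeomorph (χ.toHomeomorph τ) = τ + 0
      simp [hχ]
    rw [derivative_comp] at h1
    rw [coe_speed, ← hχ]
    exact eq_inv_of_mul_eq_one_right h1
  have hF₁ := χ₁.isCircleLift_lift
  have hF₂ := χ₂.isCircleLift_lift
  have hd : ∀ x, deriv (fun x => χ₁.lift x - χ₂.lift x) x = 0 := fun x => by
    rw [((hF₁.hasDerivAt x).fun_sub (hF₂.hasDerivAt x)).deriv, ← derivative_coe hF₁,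
      ← derivative_coe hF₂, key φ₁ χ₁ hχ₁, key φ₂ χ₂ hχ₂, hs, sub_self]
  have hc : ∀ x, χ₁.lift x - χ₂.lift x = χ₁.lift 0 - χ₂.lift 0 := fun x =>
    is_const_of_deriv_eq_zero (fun x => ((hF₁.hasDerivAt x).fun_sub
      (hF₂.hasDerivAt x)).differentiableAt) hd x 0
  have hχ : ∀ τ, χ₁ τ = χ₂ τ := by
    intro τ
    obtain ⟨x, rfl⟩ := QuotientAddGroup.mk_surjective τ
    have h1 : ((χ₁.lift x - χ₂.lift x : ℝ) : UnitAddCircle) = 0 := by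
      rw [hc x, AddCircle.coe_sub, ← hF₁.coe_eq, ← hF₂.coe_eq, sub_eq_zero]
      simpa [hχ₁, hχ₂] using h0
    rw [AddCircle.coe_sub, ← hF₁.coe_eq, ← hF₂.coe_eq, sub_eq_zero] at h1
    exact h1
  refine ext_fun fun τ => ?_
  have h2 : φ₂.toHomeomorph.symm (φ₁ τ) = τ := by
    rw [← hχ₂]
    exact (hχ (φ₁ τ)).symm.trans (by rw [hχ₁]; exact φ₁.toHomeomorph.symm_apply_apply τ)
  exact (φ₂.toHomeomorph.symm_apply_eq).1 h2

end CircleDiffeo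

end

noncomputable section

/-! ### Circle diffeomorphisms attached to periodic Riccati equations -/

theorem ContDiff.of_hasDerivAt {n : ℕ} {f f' : ℝ → ℝ} (h : ∀ x, HasDerivAt f (f' x) x)
    (hf' : ContDiff ℝ n f') : ContDiff ℝ (n + 1 : ℕ) f := by
  have : deriv f = f' := funext fun x => (h x).deriv
  push_cast
  rw [contDiff_succ_iff_deriv]
  refine ⟨fun x => (h x).differentiableAt, by simp, by rwa [this]⟩

/-- If `r` is periodic of mean `β > 0`, then the coadjoint orbit of the constant `-2β²` contains
`-2 (r' + r²)`. -/
theorem exists_circleDiffeo_of_riccati {r : ℝ → ℝ} (hr : ContDiff ℝ 1 r)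
    (hp : Function.Periodic r 1) {β : ℝ} (hβ : ∫ x in (0 : ℝ)..1, r x = β) (hβ0 : 0 < β) :
    ∃ ψ : CircleDiffeo 3, ψ 0 = 0 ∧ ∀ x : ℝ, ψ.schwarzian (x : UnitAddCircle)
      - 2 * β ^ 2 * ψ.derivative (x : UnitAddCircle) ^ 2 = -2 * (deriv r x + r x ^ 2) := by
  have hrc := hr.continuous
  have hri : ∀ a b, IntervalIntegrable r volume a b := fun a b => hrc.intervalIntegrable a b
  set R : ℝ → ℝ := fun x => ∫ y in (0 : ℝ)..x, r y with hR
  have hRd : ∀ x, HasDerivAt R (r x) x := fun x =>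
    intervalIntegral.integral_hasDerivAt_right (hri 0 x)
      (hrc.stronglyMeasurableAtFilter _ _) hrc.continuousAt
  have hR1 : ∀ x, R (x + 1) = R x + β := fun x => by
    have h1 := hp.intervalIntegral_add_eq x 0
    rw [zero_add, hβ] at h1
    rw [← h1, hR]
    exact (intervalIntegral.integral_add_adjacent_intervals (hri _ _) (hri _ _)).symm
  set e : ℝ → ℝ := fun x => Real.exp (-2 * R x) with he
  have hed : ∀ x, HasDerivAt e (e x * (-2 * r x)) x := fun x =>
    ((hRd x).const_mul (-2)).exp
  have he1 : ∀ x, e (x + 1) = Real.exp (-2 * β) * e x := fun x => by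
    simp only [he, hR1, ← Real.exp_add]; ring_nf
  have hepos : ∀ x, 0 < e x := fun x => Real.exp_pos _
  have hR2 : ContDiff ℝ (2 : ℕ) R := ContDiff.of_hasDerivAt (n := 1) hRd (by exact_mod_cast hr)
  have he2 : ContDiff ℝ (2 : ℕ) e := (contDiff_const.mul hR2).exp
  have hec := he2.continuous
  have hei : ∀ a b, IntervalIntegrable e volume a b := fun a b => hec.intervalIntegrable a b
  -- With `y = exp R`, `y'' = (r' + r²) y` and `y` is multiplied by `exp β` over a period. The
  -- product `y I` is the other Floquet solution, with multiplier `exp (-β)`, so `I` is the ratio of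
  -- the two and its Schwarzian is `-2 (r' + r²)`.
  set I : ℝ → ℝ := fun x => ∫ y in x..(x + 1), e y with hI
  set γ : ℝ := 1 - Real.exp (-2 * β) with hγ
  have hγ0 : 0 < γ := by
    have : Real.exp (-2 * β) < 1 := by
      rw [Real.exp_lt_one_iff]; linarith
    linarith
  have hId : ∀ x, HasDerivAt I (-γ * e x) x := fun x => by
    have hE : ∀ x, HasDerivAt (fun x => ∫ y in (0 : ℝ)..x, e y) (e x) x := fun x =>
      intervalIntegral.integral_hasDerivAt_right (hei 0 x)
        (hec.stronglyMeasurableAtFilter _ _) hec.continuousAt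
    have h1 : HasDerivAt (fun x => (∫ y in (0 : ℝ)..(x + 1), e y) - ∫ y in (0 : ℝ)..x, e y)
        (e (x + 1) - e x) x := ((hE (x + 1)).comp_add_const x 1).sub (hE x)
    have h2 : (fun x => (∫ y in (0 : ℝ)..(x + 1), e y) - ∫ y in (0 : ℝ)..x, e y) = I := by
      ext x
      exact intervalIntegral.integral_interval_sub_left (hei _ _) (hei _ _)
    rw [h2, he1] at h1
    convert! h1 using 1
    rw [hγ]; ring
  have hI1 : ∀ x, I (x + 1) = Real.exp (-2 * β) * I x := fun x => by
    simp only [hI]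
    rw [← intervalIntegral.integral_comp_add_right, ← intervalIntegral.integral_const_mul]
    simp only [he1]
  have hIpos : ∀ x, 0 < I x := fun x =>
    intervalIntegral.intervalIntegral_pos_of_pos (hei _ _) hepos (by linarith)
  have hI3 : ContDiff ℝ (3 : ℕ) I := ContDiff.of_hasDerivAt (n := 2) hId (contDiff_const.mul he2)
  -- Chosen so that `exp (-2 β P) = I / I 0`. The multiplier `exp (-2 β)` of `I` makes `P` of degree
  -- one, and the chain rule for the Schwarzian contributes `-2 β² P'²`.
  set P : ℝ → ℝ := fun x => -(1 / (2 * β)) * (Real.log (I x) - Real.log (I 0)) with hP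
  set d : ℝ → ℝ := fun x => γ / (2 * β) * (e x / I x) with hd
  have hPd : ∀ x, HasDerivAt P (d x) x := fun x => by
    have h1 := (((hId x).log (hIpos x).ne').sub_const (Real.log (I 0))).const_mul (-(1 / (2 * β)))
    convert! h1 using 1
    simp only [hd]
    ring
  have hdd : ∀ x, HasDerivAt d (d x * (-2 * r x + 2 * β * d x)) x := fun x => by
    have h1 := ((hed x).div (hId x) (hIpos x).ne').const_mul (γ / (2 * β))
    convert! h1 using 1
    simp only [hd]
    have := (hIpos x).ne'
    field_simp
    ring
  have hP' : deriv P = d := funext fun x => (hPd x).deriv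
  have hd' : ∀ x, deriv d x = d x * (-2 * r x + 2 * β * d x) := fun x => (hdd x).deriv
  have hdpos : ∀ x, 0 < d x := fun x =>
    mul_pos (div_pos hγ0 (by linarith)) (div_pos (hepos x) (hIpos x))
  have hP3 : ContDiff ℝ (3 : ℕ) P :=
    contDiff_const.mul ((hI3.log fun x => (hIpos x).ne').sub contDiff_const)
  have hP1 : ∀ x, P (x + 1) = P x + 1 := fun x => by
    simp only [hP]
    rw [hI1, Real.log_mul (Real.exp_pos _).ne' (hIpos x).ne', Real.log_exp]
    field_simp
    ring
  obtain ⟨ψ, hψ⟩ := CircleDiffeo.exists_of_lift P hP3 (fun x => by rw [hP']; exact hdpos x) hP1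
  refine ⟨ψ, ?_, fun x => ?_⟩
  · have h0 := hψ.coe_eq 0
    have hP0 : P 0 = 0 := by simp [hP]
    rw [hP0] at h0
    exact h0
  · rw [CircleDiffeo.schwarzian_coe hψ, CircleDiffeo.derivative_coe hψ, realSchwarzian, hP']
    have h1 : (fun y => deriv d y / d y) = fun y => -2 * r y + 2 * β * d y := by
      ext y
      rw [hd', mul_div_cancel_left₀ _ (hdpos y).ne']
    have hrd : HasDerivAt r (deriv r x) x :=
      (hr.differentiable (by norm_num) x).hasDerivAt
    have h2 : HasDerivAt (fun y => -2 * r y + 2 * β * d y)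
        (-2 * deriv r x + 2 * β * (d x * (-2 * r x + 2 * β * d x))) x :=
      (hrd.const_mul (-2)).add ((hdd x).const_mul (2 * β))
    have h3 : deriv d x / d x = -2 * r x + 2 * β * d x := congrFun h1 x
    rw [h1, h2.deriv, h3]
    ring

/-! ### Quasi-invariant measures -/

open CircleDiffeo

/-- The pairing of a function on the circle with the speed of a diffeomorphism. -/
def speedPairing (w : UnitAddCircle → ℝ) (φ : CircleDiffeo 1) : ℝ := ∫ u, w u * φ.speed u

/-- `m` is quasi-invariant under `Diff³(𝕋)` with the Schwarzian cocycle (`s = 2 / σ²`). -/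
def SchwarzianQuasiInvariant (s : ℝ) (m : Measure (CircleDiffeo 1)) : Prop :=
  ∀ (ψ : CircleDiffeo 3) (f : CircleDiffeo 1 → ℝ≥0∞), Measurable f →
    ∫⁻ φ, f (ψ.postcomp φ) * ENNReal.ofReal (Real.exp (s / 2 * speedPairing ψ.schwarzian φ)) ∂m
      = ∫⁻ φ, f φ ∂m

theorem continuous_integral_circle : Continuous fun f : C(UnitAddCircle, ℝ) => ∫ u, f u := by
  refine LipschitzWith.continuous (K := 1) (LipschitzWith.of_dist_le_mul fun f g => ?_)
  have hi : ∀ f : C(UnitAddCircle, ℝ), Integrable f := fun f =>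
    f.continuous.integrable_of_hasCompactSupport (HasCompactSupport.of_compactSpace _)
  rw [dist_eq_norm, ← integral_sub (hi f) (hi g)]
  have := norm_integral_le_of_norm_le_const (μ := (volume : Measure UnitAddCircle))
    (f := fun u => f u - g u) (C := dist f g) (Filter.Eventually.of_forall fun u => by
      rw [← dist_eq_norm]; exact ContinuousMap.dist_apply_le_dist u)
  simpa [measureReal_def, UnitAddCircle.measure_univ] using this

/-- The integral of the product of two functions on the circle. -/
def circlePairing (w : UnitAddCircle → ℝ) (q : C(UnitAddCircle, ℝ≥0)) : ℝ := ∫ u, w u * q u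

theorem continuous_circlePairing {w : UnitAddCircle → ℝ} (hw : Continuous w) :
    Continuous (circlePairing w) := by
  let W : C(UnitAddCircle, ℝ) := ⟨w, hw⟩
  let e : C(ℝ≥0, ℝ) := ⟨NNReal.toReal, NNReal.continuous_coe⟩
  have h : Continuous fun q : C(UnitAddCircle, ℝ≥0) => W * e.comp q :=
    continuous_const.mul (ContinuousMap.continuous_postcomp e)
  exact continuous_integral_circle.comp h

theorem continuous_speedPairing {w : UnitAddCircle → ℝ} (hw : Continuous w) :
    Continuous (speedPairing w) :=
  (continuous_circlePairing hw).comp continuous_speed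

theorem continuous_energy : Continuous energy := by
  have := continuous_speedPairing (w := fun _ => 1) continuous_const
  have h : energy = speedPairing fun _ => 1 := by
    ext φ; simp [speedPairing, energy_eq]
  rwa [h]

theorem CircleDiffeo.energy_nonneg (φ : CircleDiffeo 1) : 0 ≤ φ.energy :=
  integral_nonneg fun _ => sq_nonneg _

theorem continuous_symm_zero :
    Continuous fun φ : CircleDiffeo 1 => φ.toHomeomorph.symm 0 :=
  continuous_symm_eval.comp (continuous_id.prodMk continuous_const)

theorem integrable_mul_speed {w : UnitAddCircle → ℝ} (hw : Continuous w) (φ : CircleDiffeo 1) :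
    Integrable fun u => w u * (φ.speed u : ℝ) :=
  (hw.mul (NNReal.continuous_coe.comp φ.speed.continuous)).integrable_of_hasCompactSupport
    (HasCompactSupport.of_compactSpace _)

theorem continuous_schwarzian (ψ : CircleDiffeo 3) : Continuous ψ.schwarzian := by
  have hF := ψ.isCircleLift_lift
  have h3 : ContDiff ℝ 3 ψ.lift := hF.contDiff
  have h2 : ContDiff ℝ 2 (deriv ψ.lift) := ((contDiff_succ_iff_deriv (n := 2)).1 h3).2.2
  have h1 : ContDiff ℝ 1 (deriv (deriv ψ.lift)) := ((contDiff_succ_iff_deriv (n := 1)).1 h2).2.2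
  have hq : ContDiff ℝ 1 fun y => deriv (deriv ψ.lift) y / deriv ψ.lift y :=
    h1.div (h2.of_le (by norm_num)) fun x => (hF.deriv_pos x).ne'
  have h : Continuous (realSchwarzian ψ.lift) :=
    (hq.continuous_deriv le_rfl).sub ((hq.continuous.pow 2).div_const 2)
  exact continuous_quot_lift _ h

/-- The expectation of `g(φ⁻¹(0)) exp(-s ∫ w(u) φ'(φ⁻¹(u)) du)`. -/
def laplaceFunctional (s : ℝ) (m : Measure (CircleDiffeo 1)) (g : UnitAddCircle → ℝ≥0∞)
    (w : UnitAddCircle → ℝ) : ℝ≥0∞ :=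
  ∫⁻ φ, g (φ.toHomeomorph.symm 0) * ENNReal.ofReal (Real.exp (-s * speedPairing w φ)) ∂m

theorem speedPairing_const (c : ℝ) (φ : CircleDiffeo 1) :
    speedPairing (fun _ => c) φ = c * φ.energy := by
  rw [speedPairing, integral_const_mul, energy_eq]

/-- For the `ψ` attached to `r`, `w = β² ψ'² - S_ψ / 2`. The cocycle accounts for the Schwarzian
part, the rest is `β²` times the energy of `ψ ∘ φ`, and the root is unchanged because `ψ` fixes `0`.
-/
theorem SchwarzianQuasiInvariant.laplaceFunctional_riccati {s : ℝ} {m : Measure (CircleDiffeo 1)}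
    (hm : SchwarzianQuasiInvariant s m) {g : UnitAddCircle → ℝ≥0∞} (hg : Measurable g)
    {r : ℝ → ℝ} (hr : ContDiff ℝ 1 r) (hp : Function.Periodic r 1) {β : ℝ}
    (hβ : ∫ x in (0 : ℝ)..1, r x = β) (hβ0 : 0 < β) {w : UnitAddCircle → ℝ}
    (hw : ∀ x : ℝ, w (x : UnitAddCircle) = deriv r x + r x ^ 2) :
    laplaceFunctional s m g w = laplaceFunctional s m g fun _ => β ^ 2 := by
  obtain ⟨ψ, hψ0, hψ⟩ := exists_circleDiffeo_of_riccati hr hp hβ hβ0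
  have hw' : ∀ u, w u = β ^ 2 * ψ.derivative u ^ 2 - ψ.schwarzian u / 2 := by
    intro u
    obtain ⟨x, rfl⟩ := QuotientAddGroup.mk_surjective u
    have h1 := hψ x
    have h2 := hw x
    change w ((x : ℝ) : UnitAddCircle) = β ^ 2 * ψ.derivative ((x : ℝ) : UnitAddCircle) ^ 2
      - ψ.schwarzian ((x : ℝ) : UnitAddCircle) / 2
    linarith
  have hf : Measurable fun φ : CircleDiffeo 1 => g (φ.toHomeomorph.symm 0) *
      ENNReal.ofReal (Real.exp (-s * speedPairing (fun _ => β ^ 2) φ)) :=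
    (hg.comp continuous_symm_zero.measurable).mul (Real.continuous_exp.comp
      (continuous_const.mul (continuous_speedPairing continuous_const))).measurable.ennreal_ofReal
  have hψs : ψ.toHomeomorph.symm 0 = 0 := by rw [Homeomorph.symm_apply_eq]; exact hψ0.symm
  rw [laplaceFunctional, laplaceFunctional, ← hm ψ _ hf]
  refine lintegral_congr fun φ => ?_
  rw [symm_postcomp, hψs, mul_assoc, ← ENNReal.ofReal_mul (Real.exp_pos _).le, ← Real.exp_add,
    speedPairing_const, energy_postcomp]
  have hd : Continuous fun u => ψ.derivative u ^ 2 :=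
    (continuous_derivative_of_one_le (by norm_num) ψ).pow 2
  have : speedPairing w φ = β ^ 2 * (∫ u, ψ.derivative u ^ 2 * φ.speed u)
      - speedPairing ψ.schwarzian φ / 2 := by
    rw [speedPairing, speedPairing, ← integral_const_mul, ← integral_div, ← integral_sub]
    · simp only [hw']
      congr 1; ext u; ring
    · exact (integrable_mul_speed hd φ).const_mul _
    · exact (integrable_mul_speed (continuous_schwarzian ψ) φ).div_const _
  rw [this]
  congr 4
  ring

end

noncomputable section

/-! ### A periodic approximation of the unit mass at an integer -/

open Filter Topology

/-- Unnormalised periodic bump, equal to one exactly at the integers. -/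
def bumpBase (x : ℝ) : ℝ := (1 + Real.cos (2 * Real.pi * x)) / 2

/-- Normalised powers of `bumpBase`, concentrating at the integers. -/
def bump (n : ℕ) (x : ℝ) : ℝ :=
  (∫ y in Set.Icc (-(1 / 2) : ℝ) (1 / 2), bumpBase y ^ n)⁻¹ * bumpBase x ^ n

/-- The primitive of `bump n` vanishing at `-1/2`. -/
def bumpPrimitive (n : ℕ) (x : ℝ) : ℝ := ∫ y in (-(1 / 2) : ℝ)..x, bump n y

theorem continuous_bumpBase : Continuous bumpBase := by unfold bumpBase; fun_prop

theorem bumpBase_nonneg (x : ℝ) : 0 ≤ bumpBase x := by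
  unfold bumpBase; linarith [Real.neg_one_le_cos (2 * Real.pi * x)]

theorem bumpBase_zero : bumpBase 0 = 1 := by simp [bumpBase]

theorem bumpBase_lt {x : ℝ} (hx : x ∈ Set.Icc (-(1 / 2) : ℝ) (1 / 2)) (h0 : x ≠ 0) :
    bumpBase x < bumpBase 0 := by
  rw [bumpBase_zero, bumpBase]
  have h1 : Real.cos (2 * Real.pi * x) ≠ 1 := by
    intro h
    rw [Real.cos_eq_one_iff_of_lt_of_lt] at h
    · rcases mul_eq_zero.1 h with h | h
      · linarith [Real.pi_pos]
      · exact h0 h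
    · nlinarith [Real.pi_pos, hx.1]
    · nlinarith [Real.pi_pos, hx.2]
  linarith [lt_of_le_of_ne (Real.cos_le_one (2 * Real.pi * x)) h1]

theorem periodic_bumpBase : Function.Periodic bumpBase 1 := fun x => by
  rw [bumpBase, bumpBase, mul_add, mul_one, Real.cos_add_two_pi]

theorem bumpBase_neg (x : ℝ) : bumpBase (-x) = bumpBase x := by
  rw [bumpBase, bumpBase, mul_neg, Real.cos_neg]

theorem continuous_bump (n : ℕ) : Continuous (bump n) :=
  continuous_const.mul (continuous_bumpBase.pow n)

theorem bump_nonneg (n : ℕ) (x : ℝ) : 0 ≤ bump n x :=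
  mul_nonneg (inv_nonneg.2 (integral_nonneg fun y => pow_nonneg (bumpBase_nonneg y) n))
    (pow_nonneg (bumpBase_nonneg x) n)

theorem periodic_bump (n : ℕ) : Function.Periodic (bump n) 1 := fun x => by
  rw [bump, bump, periodic_bumpBase]

theorem bump_neg (n : ℕ) (x : ℝ) : bump n (-x) = bump n x := by
  rw [bump, bump, bumpBase_neg]

theorem intervalIntegrable_bump (n : ℕ) (x y : ℝ) : IntervalIntegrable (bump n) volume x y :=
  (continuous_bump n).intervalIntegrable x y

theorem intervalIntegral_eq_setIntegral_Icc (f : ℝ → ℝ) :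
    ∫ x in (-(1 / 2) : ℝ)..(1 / 2), f x = ∫ x in Set.Icc (-(1 / 2) : ℝ) (1 / 2), f x := by
  rw [intervalIntegral.integral_of_le (by norm_num), integral_Icc_eq_integral_Ioc]

theorem integral_bump (n : ℕ) : ∫ x in (-(1 / 2) : ℝ)..(1 / 2), bump n x = 1 := by
  rw [intervalIntegral_eq_setIntegral_Icc]
  simp only [bump]
  rw [integral_const_mul]
  refine inv_mul_cancel₀ (ne_of_gt ?_)
  rw [← intervalIntegral_eq_setIntegral_Icc]
  refine intervalIntegral.intervalIntegral_pos_of_pos_on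
    ((continuous_bumpBase.pow n).intervalIntegrable _ _) (fun x hx => ?_) (by norm_num)
  refine pow_pos ?_ n
  have : 0 < 1 + Real.cos (2 * Real.pi * x) := by
    have h2 : 0 < Real.cos (Real.pi * x) := Real.cos_pos_of_mem_Ioo
      ⟨by nlinarith [Real.pi_pos, hx.1], by nlinarith [Real.pi_pos, hx.2]⟩
    have h3 := Real.cos_sq (Real.pi * x)
    rw [← mul_assoc] at h3
    nlinarith
  exact half_pos this

/-- Normalised powers of a function concentrate at its unique maximum. Continuity is asked only at
`0` because indicator functions are among the test functions. -/
theorem tendsto_integral_bump_mul {g : ℝ → ℝ}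
    (hg : IntegrableOn g (Set.Icc (-(1 / 2) : ℝ) (1 / 2))) (hc : ContinuousAt g 0) :
    Tendsto (fun n => ∫ x in (-(1 / 2) : ℝ)..(1 / 2), bump n x * g x) atTop (𝓝 (g 0)) := by
  have h := tendsto_setIntegral_pow_smul_of_unique_maximum_of_isCompact_of_integrableOn
    (μ := volume) (s := Set.Icc (-(1 / 2) : ℝ) (1 / 2)) (x₀ := 0) (g := g) (c := bumpBase)
    isCompact_Icc
    continuous_bumpBase.continuousOn (fun y hy h0 => bumpBase_lt hy h0)
    (fun x _ => bumpBase_nonneg x) (by rw [bumpBase_zero]; norm_num)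
    (subset_closure (by rw [interior_Icc]; norm_num)) hg hc.continuousWithinAt
  refine h.congr fun n => ?_
  rw [intervalIntegral_eq_setIntegral_Icc, smul_eq_mul, ← integral_const_mul]
  simp only [bump, smul_eq_mul, mul_assoc]

theorem hasDerivAt_bumpPrimitive (n : ℕ) (x : ℝ) : HasDerivAt (bumpPrimitive n) (bump n x) x :=
  intervalIntegral.integral_hasDerivAt_right (intervalIntegrable_bump n _ _)
    ((continuous_bump n).stronglyMeasurableAtFilter _ _) (continuous_bump n).continuousAt

theorem monotone_bumpPrimitive (n : ℕ) : Monotone (bumpPrimitive n) :=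
  monotone_of_hasDerivAt_nonneg (hasDerivAt_bumpPrimitive n) (bump_nonneg n)

theorem bumpPrimitive_half (n : ℕ) : bumpPrimitive n (1 / 2) = 1 := integral_bump n

theorem bumpPrimitive_zero (n : ℕ) : bumpPrimitive n 0 = 1 / 2 := by
  have h1 : ∫ y in (0 : ℝ)..(1 / 2), bump n y = bumpPrimitive n 0 := by
    rw [bumpPrimitive, ← neg_zero, ← intervalIntegral.integral_comp_neg]
    simp only [bump_neg, neg_zero]
  have h2 := intervalIntegral.integral_add_adjacent_intervals
    (intervalIntegrable_bump n (-(1 / 2)) 0) (intervalIntegrable_bump n 0 (1 / 2))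
  rw [h1, integral_bump] at h2
  change bumpPrimitive n 0 + bumpPrimitive n 0 = 1 at h2
  linarith

theorem bumpPrimitive_add_one (n : ℕ) (x : ℝ) :
    bumpPrimitive n (x + 1) = bumpPrimitive n x + 1 := by
  have h1 := (periodic_bump n).intervalIntegral_add_eq x (-(1 / 2))
  rw [show (-(1 / 2) : ℝ) + 1 = 1 / 2 by norm_num, integral_bump] at h1
  have h2 := intervalIntegral.integral_add_adjacent_intervals
    (intervalIntegrable_bump n (-(1 / 2)) x) (intervalIntegrable_bump n x (x + 1))
  rw [h1] at h2
  exact h2.symm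

theorem tendsto_bumpPrimitive {x : ℝ} (hx : x ∈ Set.Icc (-(1 / 2) : ℝ) (1 / 2)) (h0 : x ≠ 0) :
    Tendsto (fun n => bumpPrimitive n x) atTop (𝓝 (if x < 0 then 0 else 1)) := by
  have h := tendsto_integral_bump_mul (g := (Set.Iic x).indicator fun _ => 1)
    ((integrableOn_const (by simp)).indicator measurableSet_Iic) (by
      rcases lt_or_gt_of_ne h0 with h | h
      · refine ContinuousAt.congr (f := fun _ => 0) continuousAt_const ?_
        filter_upwards [Ioi_mem_nhds h] with y hy
        rw [Set.indicator_of_notMem (by simpa using hy)]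
      · refine ContinuousAt.congr (f := fun _ => 1) continuousAt_const ?_
        filter_upwards [Iio_mem_nhds h] with y hy
        rw [Set.indicator_of_mem (by simpa using hy.le)])
  have hlim : (Set.Iic x).indicator (fun _ => (1 : ℝ)) 0 = if x < 0 then 0 else 1 := by
    by_cases hx0 : x < 0 <;> simp [hx0, not_le.2, not_lt.1]
  rw [hlim] at h
  refine h.congr fun n => ?_
  rw [bumpPrimitive, intervalIntegral.integral_of_le (by norm_num),
    intervalIntegral.integral_of_le hx.1]
  have : ∀ y, bump n y * (Set.Iic x).indicator (fun _ => (1 : ℝ)) y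
      = (Set.Iic x).indicator (bump n) y := fun y => by
    by_cases hy : y ∈ Set.Iic x <;> simp [hy]
  simp only [this]
  rw [setIntegral_indicator measurableSet_Iic, Set.Ioc_inter_Iic, min_eq_right hx.2]

/-! ### Riccati solutions approximating a point interaction -/

/-- A periodic function of slope `b` off the integers with an approximate jump of `-b` there. -/
def phase (a b : ℝ) (n : ℕ) (x : ℝ) : ℝ := a + b * (x - bumpPrimitive n x)

theorem hasDerivAt_phase (a b : ℝ) (n : ℕ) (x : ℝ) :
    HasDerivAt (phase a b n) (b * (1 - bump n x)) x :=
  (((hasDerivAt_id x).sub (hasDerivAt_bumpPrimitive n x)).const_mul b).const_add a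

theorem continuous_phase (a b : ℝ) (n : ℕ) : Continuous (phase a b n) :=
  continuous_iff_continuousAt.2 fun x => (hasDerivAt_phase a b n x).continuousAt

theorem periodic_phase (a b : ℝ) (n : ℕ) : Function.Periodic (phase a b n) 1 := fun x => by
  rw [phase, phase, bumpPrimitive_add_one]; ring

/-- The primitive is at most `1/2` on `[-1/2, 0]`, by evenness of the bump, and at most `1` on `[0,
1/2]`. When `b < a`, this keeps the phase away from the pole of `coth`, uniformly in `n`. -/
theorem le_phase {a b : ℝ} (hb : 0 < b) (n : ℕ) (x : ℝ) : a - b ≤ phase a b n x := by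
  have key : ∀ y ∈ Set.Icc (-(1 / 2) : ℝ) (1 / 2), a - b ≤ phase a b n y := by
    intro y hy
    have : -1 ≤ y - bumpPrimitive n y := by
      rcases le_total y 0 with h | h
      · have := monotone_bumpPrimitive n h
        rw [bumpPrimitive_zero] at this
        linarith [hy.1]
      · have := monotone_bumpPrimitive n hy.2
        rw [bumpPrimitive_half] at this
        linarith
    rw [phase]
    nlinarith
  obtain ⟨y, hy, hxy⟩ := (periodic_phase a b n).exists_mem_Ico (by norm_num) x (-(1 / 2))
  rw [hxy]
  exact key y ⟨hy.1, by linarith [hy.2]⟩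

theorem tendsto_phase (a b : ℝ) {x : ℝ} (hx : x ∈ Set.Icc (-(1 / 2) : ℝ) (1 / 2)) (h0 : x ≠ 0) :
    Tendsto (fun n => phase a b n x) atTop (𝓝 (a + b * (x - if x < 0 then 0 else 1))) :=
  ((tendsto_const_nhds.sub (tendsto_bumpPrimitive hx h0)).const_mul b).const_add a

/-- The limiting phase is a sawtooth which climbs from `a - b` just after an integer to `a` just
before the next, with slope `b`. Dominated convergence and a linear substitution on each half period
give the limit. -/
theorem tendsto_integral_comp_phase {a b C : ℝ} (hb : 0 < b) {h : ℝ → ℝ}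
    (hc : ContinuousOn h (Set.Ici (a - b))) (hC : ∀ x ∈ Set.Ici (a - b), |h x| ≤ C) :
    Tendsto (fun n => ∫ x in (-(1 / 2) : ℝ)..(1 / 2), h (phase a b n x)) atTop
      (𝓝 (b⁻¹ * ∫ y in (a - b)..a, h y)) := by
  have hlim : ∫ x in (-(1 / 2) : ℝ)..(1 / 2), h (a + b * (x - if x < 0 then 0 else 1))
      = b⁻¹ * ∫ y in (a - b)..a, h y := by
    have hi : ∀ u v, a - b ≤ u → a - b ≤ v → IntervalIntegrable h volume u v :=
      fun u v hu hv => (hc.mono fun y hy => (le_min hu hv).trans hy.1).intervalIntegrable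
    have e1 : ∫ x in (-(1 / 2) : ℝ)..0, h (a + b * (x - if x < 0 then 0 else 1))
        = ∫ x in (-(1 / 2) : ℝ)..0, h (a + b * x) := by
      refine intervalIntegral.integral_congr_ae ?_
      filter_upwards [compl_mem_ae_iff.2 (measure_singleton (0 : ℝ))] with x hx hx'
      rw [Set.uIoc_of_le (by norm_num)] at hx'
      rw [if_pos (lt_of_le_of_ne hx'.2 hx), sub_zero]
    have e2 : ∫ x in (0 : ℝ)..(1 / 2), h (a + b * (x - if x < 0 then 0 else 1))
        = ∫ x in (0 : ℝ)..(1 / 2), h ((a - b) + b * x) := by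
      refine intervalIntegral.integral_congr fun x hx => ?_
      rw [Set.uIcc_of_le (by norm_num)] at hx
      simp only [if_neg (not_lt.2 hx.1)]
      congr 1; ring
    have i1 : IntervalIntegrable (fun x => h (a + b * x)) volume (-(1 / 2)) 0 := by
      refine ContinuousOn.intervalIntegrable (hc.comp (by fun_prop) fun x hx => ?_)
      rw [Set.uIcc_of_le (by norm_num)] at hx
      simp only [Set.mem_Ici]; nlinarith [hx.1]
    have i2 : IntervalIntegrable (fun x => h ((a - b) + b * x)) volume 0 (1 / 2) := by
      refine ContinuousOn.intervalIntegrable (hc.comp (by fun_prop) fun x hx => ?_)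
      rw [Set.uIcc_of_le (by norm_num)] at hx
      simp only [Set.mem_Ici]; nlinarith [hx.1]
    rw [← intervalIntegral.integral_add_adjacent_intervals (b := 0), e1, e2,
      intervalIntegral.integral_comp_add_mul _ hb.ne',
      intervalIntegral.integral_comp_add_mul _ hb.ne', ← smul_add, add_comm, smul_eq_mul]
    · congr 1
      rw [show (a - b) + b * 0 = a - b by ring, show a + b * 0 = a by ring,
        show a + b * -(1 / 2) = a - b + b * (1 / 2) by ring]
      exact intervalIntegral.integral_add_adjacent_intervals (hi _ _ le_rfl (by linarith))
        (hi _ _ (by linarith) (by linarith))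
    · refine i1.congr_ae ?_
      rw [Set.uIoc_of_le (by norm_num)]
      filter_upwards [ae_restrict_mem measurableSet_Ioc,
        ae_restrict_of_ae (compl_mem_ae_iff.2 (measure_singleton (0 : ℝ)))] with x hx hx'
      rw [if_pos (lt_of_le_of_ne hx.2 hx'), sub_zero]
    · refine i2.congr_ae ?_
      rw [Set.uIoc_of_le (by norm_num)]
      filter_upwards [ae_restrict_mem measurableSet_Ioc] with x hx
      rw [if_neg (not_lt.2 hx.1.le)]
      congr 1; ring
  rw [← hlim]
  refine intervalIntegral.tendsto_integral_filter_of_dominated_convergence (fun _ => C) ?_ ?_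
    intervalIntegrable_const ?_
  · refine Eventually.of_forall fun n => Continuous.aestronglyMeasurable ?_
    exact hc.comp_continuous (continuous_phase a b n) fun x => le_phase hb n x
  · exact Eventually.of_forall fun n => Eventually.of_forall fun x _ => hC _ (le_phase hb n x)
  · filter_upwards [compl_mem_ae_iff.2 (measure_singleton (0 : ℝ))] with x hx hx'
    rw [Set.uIoc_of_le (by norm_num)] at hx'
    have hmem : x ∈ Set.Icc (-(1 / 2) : ℝ) (1 / 2) := ⟨hx'.1.le, hx'.2⟩
    have ht := tendsto_phase a b hmem hx
    have hge : a - b ≤ a + b * (x - if x < 0 then 0 else 1) :=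
      ge_of_tendsto' ht fun n => le_phase hb n x
    exact (hc _ hge).tendsto.comp
      (tendsto_nhdsWithin_iff.2 ⟨ht, Eventually.of_forall fun n => le_phase hb n x⟩)


/-- The Riccati solution `b coth` of the phase. -/
def pointRiccati (a b : ℝ) (n : ℕ) (x : ℝ) : ℝ :=
  b * (Real.cosh (phase a b n x) / Real.sinh (phase a b n x))

theorem hasDerivAt_coth {x : ℝ} (hx : Real.sinh x ≠ 0) :
    HasDerivAt (fun x => Real.cosh x / Real.sinh x) (-(1 / Real.sinh x ^ 2)) x := by
  convert! (Real.hasDerivAt_cosh x).div (Real.hasDerivAt_sinh x) hx using 1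
  field_simp
  linarith [Real.cosh_sq x]

theorem sinh_phase_pos {a b : ℝ} (hb : 0 < b) (hab : b < a) (n : ℕ) (x : ℝ) :
    0 < Real.sinh (phase a b n x) :=
  Real.sinh_pos_iff.2 (by linarith [le_phase (a := a) hb n x])

theorem hasDerivAt_pointRiccati {a b : ℝ} (hb : 0 < b) (hab : b < a) (n : ℕ) (x : ℝ) :
    HasDerivAt (pointRiccati a b n)
      (b ^ 2 * bump n x / Real.sinh (phase a b n x) ^ 2
        - b ^ 2 * (1 / Real.sinh (phase a b n x) ^ 2)) x := by
  have h := ((hasDerivAt_coth (sinh_phase_pos hb hab n x).ne').comp x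
    (hasDerivAt_phase a b n x)).const_mul b
  convert! h using 1
  ring

theorem contDiff_pointRiccati {a b : ℝ} (hb : 0 < b) (hab : b < a) (n : ℕ) :
    ContDiff ℝ 1 (pointRiccati a b n) := by
  have hs : Continuous fun x => Real.sinh (phase a b n x) ^ 2 :=
    (Real.continuous_sinh.comp (continuous_phase a b n)).pow 2
  have hs0 : ∀ x, Real.sinh (phase a b n x) ^ 2 ≠ 0 := fun x =>
    pow_ne_zero 2 (sinh_phase_pos hb hab n x).ne'
  exact_mod_cast ContDiff.of_hasDerivAt (n := 0) (hasDerivAt_pointRiccati hb hab n)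
    (contDiff_zero.2 (((continuous_const.mul (continuous_bump n)).div hs hs0).sub
      (continuous_const.mul (continuous_const.div hs hs0))))

theorem periodic_pointRiccati (a b : ℝ) (n : ℕ) : Function.Periodic (pointRiccati a b n) 1 :=
  fun x => by rw [pointRiccati, pointRiccati, periodic_phase]

/-- The potential `r' + r²` of `r = pointRiccati a b n`, on the line. -/
def pointPotential (a b : ℝ) (n : ℕ) (x : ℝ) : ℝ :=
  b ^ 2 + b ^ 2 * bump n x / Real.sinh (phase a b n x) ^ 2

/-- As `coth² - 1/sinh² = 1`, the slope `b` of the phase accounts for the constant `b²`, and only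
the bump contributes the rest. The smoothed point interaction is thus solved exactly, without
perturbation theory. -/
theorem deriv_pointRiccati_add_sq {a b : ℝ} (hb : 0 < b) (hab : b < a) (n : ℕ) (x : ℝ) :
    pointPotential a b n x = deriv (pointRiccati a b n) x + pointRiccati a b n x ^ 2 := by
  rw [(hasDerivAt_pointRiccati hb hab n x).deriv, pointPotential, pointRiccati]
  have := (sinh_phase_pos hb hab n x).ne'
  field_simp
  rw [Real.cosh_sq]
  ring

theorem periodic_pointPotential (a b : ℝ) (n : ℕ) : Function.Periodic (pointPotential a b n) 1 :=
  fun x => by rw [pointPotential, pointPotential, periodic_phase, periodic_bump]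

theorem continuous_pointPotential {a b : ℝ} (hb : 0 < b) (hab : b < a) (n : ℕ) :
    Continuous (pointPotential a b n) :=
  continuous_const.add ((continuous_const.mul (continuous_bump n)).div
    ((Real.continuous_sinh.comp (continuous_phase a b n)).pow 2)
    fun x => pow_ne_zero 2 (sinh_phase_pos hb hab n x).ne')

theorem le_pointPotential (a b : ℝ) (n : ℕ) (x : ℝ) : b ^ 2 ≤ pointPotential a b n x :=
  le_add_of_nonneg_right (div_nonneg (mul_nonneg (sq_nonneg _) (bump_nonneg n x)) (sq_nonneg _))

theorem sinh_pos_of_mem_Ici {c x : ℝ} (hc : 0 < c) (hx : x ∈ Set.Ici c) : 0 < Real.sinh x :=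
  Real.sinh_pos_iff.2 (hc.trans_le hx)

/-- The mean of `pointRiccati` converges to the Lyapunov exponent of the point interaction. -/
theorem tendsto_integral_pointRiccati {a b : ℝ} (hb : 0 < b) (hab : b < a) :
    Tendsto (fun n => ∫ x in (0 : ℝ)..1, pointRiccati a b n x) atTop
      (𝓝 (Real.log (Real.sinh a / Real.sinh (a - b)))) := by
  have hc0 : 0 < a - b := sub_pos.2 hab
  have hs0 : 0 < Real.sinh (a - b) := Real.sinh_pos_iff.2 hc0
  have hcont : ContinuousOn (fun y => b * (Real.cosh y / Real.sinh y)) (Set.Ici (a - b)) :=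
    continuousOn_const.mul (Real.continuous_cosh.continuousOn.div Real.continuous_sinh.continuousOn
      fun x hx => (sinh_pos_of_mem_Ici hc0 hx).ne')
  have h := tendsto_integral_comp_phase (a := a) (C := b * (1 + 1 / Real.sinh (a - b))) hb hcont
    (fun x hx => by
      have hx0 := sinh_pos_of_mem_Ici hc0 hx
      rw [abs_of_nonneg (mul_nonneg hb.le (div_nonneg (Real.cosh_pos x).le hx0.le))]
      gcongr
      have h1 : Real.cosh x ≤ Real.sinh x + 1 := by
        have := Real.cosh_sub_sinh x
        have : Real.exp (-x) ≤ 1 := by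
          rw [Real.exp_le_one_iff]; linarith [Set.mem_Ici.1 hx]
        linarith
      calc Real.cosh x / Real.sinh x ≤ (Real.sinh x + 1) / Real.sinh x := by gcongr
        _ = 1 + 1 / Real.sinh x := by field_simp
        _ ≤ 1 + 1 / Real.sinh (a - b) := by
          gcongr
          exact Real.sinh_le_sinh.2 hx)
  have hint : b⁻¹ * ∫ y in (a - b)..a, b * (Real.cosh y / Real.sinh y)
      = Real.log (Real.sinh a / Real.sinh (a - b)) := by
    rw [intervalIntegral.integral_const_mul, inv_mul_cancel_left₀ hb.ne',
      Real.log_div (Real.sinh_pos_iff.2 (hb.trans hab)).ne' hs0.ne']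
    refine intervalIntegral.integral_eq_sub_of_hasDerivAt (f := fun y => Real.log (Real.sinh y))
      (fun x hx => ?_) (ContinuousOn.intervalIntegrable ?_)
    · rw [Set.uIcc_of_le (by linarith)] at hx
      exact (Real.hasDerivAt_sinh x).log (sinh_pos_of_mem_Ici hc0 hx.1).ne'
    · rw [Set.uIcc_of_le (by linarith)]
      exact Real.continuous_cosh.continuousOn.div Real.continuous_sinh.continuousOn
        fun x hx => (sinh_pos_of_mem_Ici hc0 hx.1).ne'
  rw [hint] at h
  refine h.congr fun n => ?_
  have := (periodic_pointRiccati a b n).intervalIntegral_add_eq (-(1 / 2)) 0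
  rw [show (-(1 / 2) : ℝ) + 1 = 1 / 2 by norm_num, zero_add] at this
  exact this

/-- Because `coth ≥ 1` on the positive axis. This keeps the exponents in the range where the Laplace
functional is finite and continuous. -/
theorem le_integral_pointRiccati {a b : ℝ} (hb : 0 < b) (hab : b < a) (n : ℕ) :
    b ≤ ∫ x in (0 : ℝ)..1, pointRiccati a b n x := by
  have h : ∫ _ in (0 : ℝ)..1, b ≤ ∫ x in (0 : ℝ)..1, pointRiccati a b n x := by
    refine intervalIntegral.integral_mono_on zero_le_one intervalIntegrable_const
      ((contDiff_pointRiccati hb hab n).continuous.intervalIntegrable _ _) fun x _ => ?_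
    refine le_mul_of_one_le_right hb.le ?_
    rw [one_le_div (sinh_phase_pos hb hab n x)]
    exact (Real.sinh_lt_cosh _).le
  simpa using h

/-- The strength of the point interaction. -/
def pointStrength (a b : ℝ) : ℝ :=
  b * (Real.cosh (a - b) / Real.sinh (a - b) - Real.cosh a / Real.sinh a)

/-- Beyond `b²`, the potential is a nonnegative kernel `D n`, bounded by a multiple of the bump and
with mass tending to the point strength; it therefore converges weakly to a multiple of the unit
mass at `0`. -/
theorem tendsto_integral_pointPotential {a b : ℝ} (hb : 0 < b) (hab : b < a) {q : ℝ → ℝ}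
    (hq : Continuous q) :
    Tendsto (fun n => ∫ x in (-(1 / 2) : ℝ)..(1 / 2), pointPotential a b n x * q x) atTop
      (𝓝 (b ^ 2 * (∫ x in (-(1 / 2) : ℝ)..(1 / 2), q x) + pointStrength a b * q 0)) := by
  have hc0 : 0 < a - b := sub_pos.2 hab
  have hs0 : 0 < Real.sinh (a - b) := Real.sinh_pos_iff.2 hc0
  set D : ℕ → ℝ → ℝ := fun n x => b ^ 2 * bump n x / Real.sinh (phase a b n x) ^ 2 with hD
  have hinvc : ∀ n, Continuous fun x => 1 / Real.sinh (phase a b n x) ^ 2 := fun n =>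
    continuous_const.div ((Real.continuous_sinh.comp (continuous_phase a b n)).pow 2)
      fun x => pow_ne_zero 2 (sinh_phase_pos hb hab n x).ne'
  have hDc : ∀ n, Continuous (D n) := fun n => by
    have : Continuous fun x => b ^ 2 * bump n x * (1 / Real.sinh (phase a b n x) ^ 2) :=
      (continuous_const.mul (continuous_bump n)).mul (hinvc n)
    simpa only [hD, mul_one_div] using this
  have hinv : ∀ x ∈ Set.Ici (a - b), 1 / Real.sinh x ^ 2 ≤ 1 / Real.sinh (a - b) ^ 2 := by
    intro x hx
    have := Real.sinh_le_sinh.2 (Set.mem_Ici.1 hx)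
    gcongr
  have hcont : ContinuousOn (fun y => b ^ 2 * (1 / Real.sinh y ^ 2)) (Set.Ici (a - b)) :=
    continuousOn_const.mul (continuousOn_const.div (Real.continuous_sinh.continuousOn.pow 2)
      fun x hx => pow_ne_zero 2 (sinh_pos_of_mem_Ici hc0 hx).ne')
  have hmass : Tendsto (fun n => ∫ x in (-(1 / 2) : ℝ)..(1 / 2), D n x) atTop
      (𝓝 (pointStrength a b)) := by
    have h := tendsto_integral_comp_phase (a := a) (C := b ^ 2 * (1 / Real.sinh (a - b) ^ 2)) hb
      hcont (fun x hx => by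
        rw [abs_of_nonneg (by positivity)]
        exact mul_le_mul_of_nonneg_left (hinv x hx) (sq_nonneg b))
    have hint : b⁻¹ * ∫ y in (a - b)..a, b ^ 2 * (1 / Real.sinh y ^ 2) = pointStrength a b := by
      have h1 : ∫ y in (a - b)..a, b ^ 2 * (1 / Real.sinh y ^ 2)
          = -b ^ 2 * (Real.cosh a / Real.sinh a)
            - -b ^ 2 * (Real.cosh (a - b) / Real.sinh (a - b)) := by
        refine intervalIntegral.integral_eq_sub_of_hasDerivAt
          (f := fun y => -b ^ 2 * (Real.cosh y / Real.sinh y))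
          (fun x hx => ?_) (ContinuousOn.intervalIntegrable (hcont.mono fun x hx => ?_))
        · rw [Set.uIcc_of_le (by linarith)] at hx
          convert! (hasDerivAt_coth (sinh_pos_of_mem_Ici hc0 hx.1).ne').const_mul (-b ^ 2) using 1
          ring
        · rw [Set.uIcc_of_le (by linarith)] at hx
          exact hx.1
      rw [h1, pointStrength]
      field_simp
      ring
    rw [hint] at h
    refine h.congr fun n => ?_
    -- The derivative of a periodic function has mean zero. So `D n` has the same mass as `b² /
    -- sinh²` of the phase, whose limit follows without resolving the product of bump and phase near
    -- the integer.
    have h0 : ∫ x in (-(1 / 2) : ℝ)..(1 / 2), (D n x - b ^ 2 * (1 / Real.sinh (phase a b n x) ^ 2))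
        = 0 := by
      rw [intervalIntegral.integral_eq_sub_of_hasDerivAt
        (fun x _ => hasDerivAt_pointRiccati hb hab n x)
        (((hDc n).sub (continuous_const.mul (hinvc n))).intervalIntegrable _ _)]
      have := periodic_pointRiccati a b n (-(1 / 2))
      rw [show (-(1 / 2) : ℝ) + 1 = 1 / 2 by norm_num] at this
      rw [this, sub_self]
    have hi : IntervalIntegrable (fun x => b ^ 2 * (1 / Real.sinh (phase a b n x) ^ 2)) volume
        (-(1 / 2)) (1 / 2) := (continuous_const.mul (hinvc n)).intervalIntegrable _ _
    rw [intervalIntegral.integral_sub ((hDc n).intervalIntegrable _ _) hi] at h0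
    linarith
  have herr : Tendsto (fun n => ∫ x in (-(1 / 2) : ℝ)..(1 / 2), D n x * (q x - q 0)) atTop
      (𝓝 0) := by
    have hq' : Continuous fun x => b ^ 2 / Real.sinh (a - b) ^ 2 * |q x - q 0| := by fun_prop
    have h := tendsto_integral_bump_mul
      (g := fun x => b ^ 2 / Real.sinh (a - b) ^ 2 * |q x - q 0|)
      (hq'.continuousOn.integrableOn_compact isCompact_Icc) hq'.continuousAt
    simp only [sub_self, abs_zero, mul_zero] at h
    refine squeeze_zero_norm (fun n => ?_) h
    rw [Real.norm_eq_abs]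
    refine (intervalIntegral.abs_integral_le_integral_abs (by norm_num)).trans
      (intervalIntegral.integral_mono_on (by norm_num) ?_ ?_ fun x _ => ?_)
    · exact ((hDc n).mul (hq.sub continuous_const)).abs.intervalIntegrable _ _
    · exact ((continuous_bump n).mul hq').intervalIntegrable _ _
    · have hDn : 0 ≤ D n x :=
        div_nonneg (mul_nonneg (sq_nonneg _) (bump_nonneg n x)) (sq_nonneg _)
      rw [abs_mul, abs_of_nonneg hDn, ← mul_assoc]
      refine mul_le_mul_of_nonneg_right ?_ (abs_nonneg _)
      have h1 := mul_le_mul_of_nonneg_left (hinv _ (le_phase (a := a) hb n x))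
        (mul_nonneg (sq_nonneg b) (bump_nonneg n x))
      rw [mul_one_div, mul_one_div] at h1
      refine h1.trans (le_of_eq ?_)
      ring
  have hsum := (herr.add (hmass.mul_const (q 0))).const_add
    (b ^ 2 * ∫ x in (-(1 / 2) : ℝ)..(1 / 2), q x)
  rw [zero_add] at hsum
  refine hsum.congr fun n => ?_
  rw [← intervalIntegral.integral_const_mul, ← intervalIntegral.integral_mul_const,
    ← intervalIntegral.integral_add, ← intervalIntegral.integral_add]
  · refine intervalIntegral.integral_congr fun x _ => ?_
    simp only [hD, pointPotential]
    ring
  · exact (continuous_const.mul hq).intervalIntegrable _ _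
  · exact (((hDc n).mul (hq.sub continuous_const)).add
      ((hDc n).mul continuous_const)).intervalIntegrable _ _
  · exact ((hDc n).mul (hq.sub continuous_const)).intervalIntegrable _ _
  · exact ((hDc n).mul continuous_const).intervalIntegrable _ _

end

noncomputable section

open Filter Topology CircleDiffeo

/-! ### The Laplace functional of a point interaction -/

theorem exists_forall_le_of_continuousMap (g : C(UnitAddCircle, ℝ≥0)) :
    ∃ C : ℝ≥0, ∀ u, g u ≤ C := by
  obtain ⟨C, hC⟩ := (isCompact_range g.continuous).bddAbove
  exact ⟨C, fun u => hC ⟨u, rfl⟩⟩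

theorem measurable_weight (g : C(UnitAddCircle, ℝ≥0)) {x : CircleDiffeo 1 → ℝ}
    (hx : Measurable x) : Measurable fun φ : CircleDiffeo 1 =>
      (g (φ.toHomeomorph.symm 0) : ℝ≥0∞) * ENNReal.ofReal (Real.exp (x φ)) :=
  (g.continuous.comp continuous_symm_zero).measurable.coe_nnreal_ennreal.mul
    (Real.measurable_exp.comp hx).ennreal_ofReal

section

variable {s : ℝ} {m : Measure (CircleDiffeo 1)} {b₀ : ℝ}

theorem lintegral_weight_lt_top (hs : 0 < s)
    (hfin : laplaceFunctional s m 1 (fun _ => b₀ ^ 2) < ∞)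
    (g : C(UnitAddCircle, ℝ≥0)) {x : CircleDiffeo 1 → ℝ} (hx : ∀ φ, b₀ ^ 2 * φ.energy ≤ x φ) :
    ∫⁻ φ, (g (φ.toHomeomorph.symm 0) : ℝ≥0∞) * ENNReal.ofReal (Real.exp (-s * x φ)) ∂m < ∞ := by
  obtain ⟨C, hC⟩ := exists_forall_le_of_continuousMap g
  refine lt_of_le_of_lt (lintegral_mono (g := fun φ =>
    (C : ℝ≥0∞) * ENNReal.ofReal (Real.exp (-s * (b₀ ^ 2 * φ.energy)))) fun φ => ?_) ?_
  · refine mul_le_mul' (ENNReal.coe_le_coe.2 (hC _)) (ENNReal.ofReal_le_ofReal (Real.exp_le_exp.2 ?_))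
    nlinarith [hx φ]
  · rw [lintegral_const_mul' _ _ ENNReal.coe_ne_top]
    refine ENNReal.mul_lt_top ENNReal.coe_lt_top ?_
    simpa [laplaceFunctional, speedPairing_const] using hfin

/-- Dominated convergence with the integrable majorant `g · exp (-s b₀² energy)`; this is why every
exponent is required to dominate `b₀² · energy`. -/
theorem tendsto_lintegral_weight {ι : Type*} {l : Filter ι} [l.IsCountablyGenerated] (hs : 0 < s)
    (hfin : laplaceFunctional s m 1 (fun _ => b₀ ^ 2) < ∞)
    (g : C(UnitAddCircle, ℝ≥0)) {x : ι → CircleDiffeo 1 → ℝ} {y : CircleDiffeo 1 → ℝ}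
    (hm : ∀ i, Measurable (x i)) (hx : ∀ᶠ i in l, ∀ φ, b₀ ^ 2 * φ.energy ≤ x i φ)
    (hlim : ∀ φ, Tendsto (fun i => x i φ) l (𝓝 (y φ))) :
    Tendsto (fun i => ∫⁻ φ, (g (φ.toHomeomorph.symm 0) : ℝ≥0∞) *
        ENNReal.ofReal (Real.exp (-s * x i φ)) ∂m) l
      (𝓝 (∫⁻ φ, (g (φ.toHomeomorph.symm 0) : ℝ≥0∞) *
        ENNReal.ofReal (Real.exp (-s * y φ)) ∂m)) := by
  refine tendsto_lintegral_filter_of_dominated_convergence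
    (fun φ => (g (φ.toHomeomorph.symm 0) : ℝ≥0∞) *
      ENNReal.ofReal (Real.exp (-s * (b₀ ^ 2 * φ.energy)))) ?_ ?_ ?_ ?_
  · exact Eventually.of_forall fun i => measurable_weight g ((hm i).const_mul (-s))
  · filter_upwards [hx] with i hi
    refine Eventually.of_forall fun φ => ?_
    refine mul_le_mul' le_rfl (ENNReal.ofReal_le_ofReal (Real.exp_le_exp.2 ?_))
    nlinarith [hi φ]
  · exact (lintegral_weight_lt_top hs hfin g fun φ => le_rfl).ne
  · refine Eventually.of_forall fun φ => ?_
    refine ENNReal.Tendsto.const_mul ?_ (Or.inr ENNReal.coe_ne_top)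
    exact ENNReal.tendsto_ofReal ((Real.continuous_exp.tendsto _).comp ((hlim φ).const_mul (-s)))

theorem laplaceFunctional_const (g : UnitAddCircle → ℝ≥0∞) (c : ℝ) :
    laplaceFunctional s m g (fun _ => c) = ∫⁻ φ, g (φ.toHomeomorph.symm 0) *
      ENNReal.ofReal (Real.exp (-s * (c * φ.energy))) ∂m := by
  simp only [laplaceFunctional, speedPairing_const]

theorem laplaceFunctional_const_lt_top (hs : 0 < s) (hb₀ : 0 < b₀)
    (hfin : laplaceFunctional s m 1 (fun _ => b₀ ^ 2) < ∞) (g : C(UnitAddCircle, ℝ≥0)) {b : ℝ}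
    (hb : b₀ ≤ b) : laplaceFunctional s m (fun u => g u) (fun _ => b ^ 2) < ∞ := by
  rw [laplaceFunctional_const]
  refine lintegral_weight_lt_top hs hfin g fun φ => ?_
  have := φ.energy_nonneg
  gcongr

theorem tendsto_laplaceFunctional_const {ι : Type*} {l : Filter ι} [l.IsCountablyGenerated]
    (hs : 0 < s) (hb₀ : 0 < b₀)
    (hfin : laplaceFunctional s m 1 (fun _ => b₀ ^ 2) < ∞) (g : C(UnitAddCircle, ℝ≥0))
    {β : ι → ℝ} {b : ℝ} (hβ : ∀ᶠ i in l, b₀ ≤ β i) (hlim : Tendsto β l (𝓝 b)) :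
    Tendsto (fun i => laplaceFunctional s m (fun u => g u) (fun _ => β i ^ 2)) l
      (𝓝 (laplaceFunctional s m (fun u => g u) (fun _ => b ^ 2))) := by
  simp only [laplaceFunctional_const]
  refine tendsto_lintegral_weight hs hfin g
    (fun i => (continuous_const.mul continuous_energy).measurable) ?_
    fun φ => (hlim.pow 2).mul_const _
  filter_upwards [hβ] with i hi φ
  have := φ.energy_nonneg
  gcongr

/-- The Riccati reduction holds exactly for each smoothed potential. On one side the potentials
converge to `b²` plus a unit mass at `0` times the strength, on the other the means of the Riccati
solutions converge. -/
theorem lintegral_pointInteraction (hs : 0 < s) (hb₀ : 0 < b₀) (hm : SchwarzianQuasiInvariant s m)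
    (hfin : laplaceFunctional s m 1 (fun _ => b₀ ^ 2) < ∞) (g : C(UnitAddCircle, ℝ≥0)) {a b : ℝ}
    (hb : b₀ ≤ b) (hab : b < a) :
    ∫⁻ φ, (g (φ.toHomeomorph.symm 0) : ℝ≥0∞) * ENNReal.ofReal (Real.exp
        (-s * (b ^ 2 * φ.energy + pointStrength a b * φ.speed 0))) ∂m
      = laplaceFunctional s m (fun u => g u)
          fun _ => Real.log (Real.sinh a / Real.sinh (a - b)) ^ 2 := by
  have hb' : 0 < b := hb₀.trans_le hb
  let w : ℕ → UnitAddCircle → ℝ := fun n => (periodic_pointPotential a b n).lift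
  have hwc : ∀ n, Continuous (w n) := fun n =>
    continuous_quot_lift _ (continuous_pointPotential hb' hab n)
  have hwx : ∀ n (x : ℝ), w n (x : UnitAddCircle) = pointPotential a b n x := fun n x => rfl
  have hwge : ∀ n u, b ^ 2 ≤ w n u := fun n u => by
    obtain ⟨x, rfl⟩ := QuotientAddGroup.mk_surjective u
    exact le_pointPotential a b n x
  have hβ0 : ∀ n, 0 < ∫ x in (0 : ℝ)..1, pointRiccati a b n x := fun n =>
    hb'.trans_le (le_integral_pointRiccati hb' hab n)
  have heq : ∀ n, laplaceFunctional s m (fun u => g u) (w n) = laplaceFunctional s m (fun u => g u)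
      fun _ => (∫ x in (0 : ℝ)..1, pointRiccati a b n x) ^ 2 := fun n =>
    hm.laplaceFunctional_riccati g.continuous.measurable.coe_nnreal_ennreal
      (contDiff_pointRiccati hb' hab n) (periodic_pointRiccati a b n) rfl (hβ0 n)
      fun x => deriv_pointRiccati_add_sq hb' hab n x
  have hR := tendsto_laplaceFunctional_const hs hb₀ hfin g
    (Eventually.of_forall fun n => hb.trans (le_integral_pointRiccati hb' hab n))
    (tendsto_integral_pointRiccati hb' hab)
  simp only [← heq] at hR
  refine tendsto_nhds_unique (tendsto_lintegral_weight hs hfin g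
    (fun n => (continuous_speedPairing (hwc n)).measurable) ?_ fun φ => ?_) hR
  · refine Eventually.of_forall fun n φ => ?_
    rw [← speedPairing_const]
    refine integral_mono (integrable_mul_speed continuous_const φ)
      (integrable_mul_speed (hwc n) φ) fun u => ?_
    exact mul_le_mul_of_nonneg_right ((pow_le_pow_left₀ hb₀.le hb 2).trans (hwge n u))
      (φ.speed_pos u).le
  · have hq : Continuous fun x : ℝ => (φ.speed (x : UnitAddCircle) : ℝ) :=
      NNReal.continuous_coe.comp (φ.speed.continuous.comp (AddCircle.continuous_mk' 1))
    have h := tendsto_integral_pointPotential hb' hab hq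
    have hE : ∫ x in (-(1 / 2) : ℝ)..(1 / 2), (φ.speed (x : UnitAddCircle) : ℝ) = φ.energy := by
      have := UnitAddCircle.intervalIntegral_preimage (-(1 / 2)) fun u => (φ.speed u : ℝ)
      rw [show (-(1 / 2) : ℝ) + 1 = 1 / 2 by norm_num] at this
      rw [this, energy_eq]
    rw [hE] at h
    refine h.congr fun n => ?_
    have := UnitAddCircle.intervalIntegral_preimage (-(1 / 2)) fun u => w n u * (φ.speed u : ℝ)
    rw [show (-(1 / 2) : ℝ) + 1 = 1 / 2 by norm_num] at this
    exact this

/-! ### Strength and Floquet exponent of a point interaction -/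

theorem exists_sinh_eq {b β : ℝ} (hb : 0 < b) (hβ : b < β) :
    ∃ a, b < a ∧ Real.sinh a = Real.exp β * Real.sinh (a - b) := by
  have h1 : 0 < Real.exp β - Real.exp b := sub_pos.2 (Real.exp_lt_exp.2 hβ)
  have h2 : Real.exp (-b) < Real.exp b := Real.exp_lt_exp.2 (by linarith)
  have h3 : 1 < (Real.exp β - Real.exp (-b)) / (Real.exp β - Real.exp b) := by
    rw [one_lt_div h1]; linarith
  -- For `a = x + b` the equation becomes `exp (2x) (exp β - exp b) = exp β - exp (-b)`.
  set x := Real.log ((Real.exp β - Real.exp (-b)) / (Real.exp β - Real.exp b)) / 2 with hx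
  have hx0 : 0 < x := half_pos (Real.log_pos h3)
  have hx2 : Real.exp x * Real.exp x * (Real.exp β - Real.exp b)
      = Real.exp β - Real.exp (-b) := by
    rw [← Real.exp_add, hx, add_halves, Real.exp_log (by linarith)]
    field_simp
  refine ⟨x + b, by linarith, ?_⟩
  rw [add_sub_cancel_right, Real.sinh_eq, Real.sinh_eq, neg_add, Real.exp_add, Real.exp_add,
    Real.exp_neg x]
  have := (Real.exp_pos x).ne'
  field_simp
  linear_combination -hx2

/-- The addition formulas express `coth (a - b)` through `exp β` and `coth a` through `exp (-β)`.
The result is the discriminant relation `cosh β = cosh b + c sinh b / (2b)`, half the trace of the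
monodromy of `b² + c δ₀`. -/
theorem pointStrength_eq {a b β : ℝ} (hb : 0 < b) (hab : b < a)
    (h : Real.sinh a = Real.exp β * Real.sinh (a - b)) :
    pointStrength a b = 2 * b / Real.sinh b * (Real.cosh β - Real.cosh b) := by
  have hsb : 0 < Real.sinh b := Real.sinh_pos_iff.2 hb
  have hsa : 0 < Real.sinh a := Real.sinh_pos_iff.2 (hb.trans hab)
  have hsab : 0 < Real.sinh (a - b) := Real.sinh_pos_iff.2 (sub_pos.2 hab)
  have e1 : Real.sinh a = Real.sinh (a - b) * Real.cosh b + Real.cosh (a - b) * Real.sinh b := by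
    rw [← Real.sinh_add, sub_add_cancel]
  have e2 : Real.sinh (a - b) = Real.sinh a * Real.cosh b - Real.cosh a * Real.sinh b :=
    Real.sinh_sub a b
  have c1 : Real.cosh (a - b) / Real.sinh (a - b) = (Real.exp β - Real.cosh b) / Real.sinh b := by
    rw [div_eq_div_iff hsab.ne' hsb.ne']
    linear_combination h - e1
  have c2 : Real.cosh a / Real.sinh a = (Real.cosh b - Real.exp (-β)) / Real.sinh b := by
    have h' : Real.sinh (a - b) = Real.exp (-β) * Real.sinh a := by
      rw [h, ← mul_assoc, ← Real.exp_add, neg_add_cancel, Real.exp_zero, one_mul]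
    rw [div_eq_div_iff hsa.ne' hsb.ne']
    linear_combination e2 - h'
  rw [pointStrength, c1, c2, Real.cosh_eq β]
  field_simp
  ring

theorem laplaceFunctional_const_eq_pointInteraction (hs : 0 < s) (hb₀ : 0 < b₀)
    (hm : SchwarzianQuasiInvariant s m)
    (hfin : laplaceFunctional s m 1 (fun _ => b₀ ^ 2) < ∞) (g : C(UnitAddCircle, ℝ≥0)) {b β : ℝ}
    (hb : b₀ ≤ b) (hβ : b < β) :
    laplaceFunctional s m (fun u => g u) (fun _ => β ^ 2)
      = ∫⁻ φ, (g (φ.toHomeomorph.symm 0) : ℝ≥0∞) * ENNReal.ofReal (Real.exp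
        (-s * (b ^ 2 * φ.energy +
          2 * b / Real.sinh b * (Real.cosh β - Real.cosh b) * φ.speed 0))) ∂m := by
  have hb' : 0 < b := hb₀.trans_le hb
  obtain ⟨a, hab, ha⟩ := exists_sinh_eq hb' hβ
  have hsab : 0 < Real.sinh (a - b) := Real.sinh_pos_iff.2 (sub_pos.2 hab)
  have h := lintegral_pointInteraction hs hb₀ hm hfin g hb hab
  rw [pointStrength_eq hb' hab ha, ha, mul_div_cancel_right₀ _ hsab.ne', Real.log_exp] at h
  exact h.symm

/-! ### The renewal identity -/

theorem lintegral_sinh_mul_exp {c : ℝ} (hc : 0 < c) {b : ℝ} (hb : 0 < b) :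
    ∫⁻ β in Set.Ioi b, ENNReal.ofReal (Real.sinh β * Real.exp (-c * (Real.cosh β - Real.cosh b)))
      = ENNReal.ofReal (1 / c) := by
  have hd : ∀ x ∈ Set.Ici b, HasDerivAt
      (fun β => -(1 / c) * Real.exp (-c * (Real.cosh β - Real.cosh b)))
      (Real.sinh x * Real.exp (-c * (Real.cosh x - Real.cosh b))) x := fun x _ => by
    have := ((((Real.hasDerivAt_cosh x).sub_const (Real.cosh b)).const_mul (-c)).exp).const_mul
      (-(1 / c))
    convert! this using 1
    field_simp
  have hn : ∀ x ∈ Set.Ioi b, 0 ≤ Real.sinh x * Real.exp (-c * (Real.cosh x - Real.cosh b)) :=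
    fun x hx => mul_nonneg (Real.sinh_pos_iff.2 (hb.trans hx)).le (Real.exp_pos _).le
  have ht : Tendsto (fun β => -(1 / c) * Real.exp (-c * (Real.cosh β - Real.cosh b))) atTop
      (𝓝 0) := by
    have h1 : Tendsto Real.cosh atTop atTop := by
      refine tendsto_atTop_mono (fun x => ?_) (Real.tendsto_exp_atTop.atTop_div_const two_pos)
      rw [Real.cosh_eq]
      linarith [Real.exp_pos (-x)]
    have h2 : Tendsto (fun β => -c * (Real.cosh β - Real.cosh b)) atTop atBot :=
      (tendsto_atTop_add_const_right _ (-Real.cosh b) h1).const_mul_atTop_of_neg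
        (neg_lt_zero.2 hc)
    simpa using (Real.tendsto_exp_atBot.comp h2).const_mul (-(1 / c))
  rw [← ofReal_integral_eq_lintegral_ofReal (integrableOn_Ioi_deriv_of_nonneg' hd hn ht)
    ((ae_restrict_mem measurableSet_Ioi).mono hn), integral_Ioi_of_hasDerivAt_of_nonneg' hd hn ht]
  simp

theorem speed_postcomp_rotation (τ u : UnitAddCircle) (φ : CircleDiffeo 1) :
    ((rotation 3 τ).postcomp φ).speed u = φ.speed (u - τ) := by
  have hR : (rotation 3 τ).toHomeomorph.symm u = u - τ := by
    rw [Homeomorph.symm_apply_eq]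
    exact (sub_add_cancel u τ).symm
  ext
  rw [coe_speed, coe_speed, symm_postcomp, hR, postcomp, derivative_comp, derivative_rotation,
    one_mul]

theorem lintegral_rotation (hm : SchwarzianQuasiInvariant s m) (τ : UnitAddCircle)
    {f : CircleDiffeo 1 → ℝ≥0∞} (hf : Measurable f) :
    ∫⁻ φ, f ((rotation 3 τ).postcomp φ) ∂m = ∫⁻ φ, f φ ∂m := by
  rw [← hm (rotation 3 τ) f hf]
  refine lintegral_congr fun φ => ?_
  simp [speedPairing, schwarzian_rotation]

theorem energy_postcomp_rotation (τ : UnitAddCircle) (φ : CircleDiffeo 1) :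
    ((rotation 3 τ).postcomp φ).energy = φ.energy := by
  rw [energy_postcomp, energy_eq]
  simp [derivative_rotation]

/-- Rotations have zero Schwarzian, so `m` is invariant under composing with them on the left, and
the evaluation point `0` may be replaced by any `u`. Averaging over `u` and changing variables for
fixed `φ` removes the speed and decouples `g`. -/
theorem lintegral_div_speed [SFinite m] (hm : SchwarzianQuasiInvariant s m)
    (g : C(UnitAddCircle, ℝ≥0)) (c : ℝ) :
    ∫⁻ φ, (g (φ.toHomeomorph.symm 0) : ℝ≥0∞) * ENNReal.ofReal (1 / φ.speed 0) *
        ENNReal.ofReal (Real.exp (-s * (c * φ.energy))) ∂m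
      = (∫⁻ u, g u) * laplaceFunctional s m 1 fun _ => c := by
  set f : UnitAddCircle → CircleDiffeo 1 → ℝ≥0∞ := fun u φ =>
    (g (φ.toHomeomorph.symm u) : ℝ≥0∞) * ENNReal.ofReal (1 / φ.speed u) *
      ENNReal.ofReal (Real.exp (-s * (c * φ.energy))) with hf
  have hswap : Continuous fun p : UnitAddCircle × CircleDiffeo 1 => (p.2, p.1) := continuous_swap
  have hc1 : Continuous fun p : UnitAddCircle × CircleDiffeo 1 =>
      g (p.2.toHomeomorph.symm p.1) := g.continuous.comp (continuous_symm_eval.comp hswap)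
  have hc2 : Continuous fun p : UnitAddCircle × CircleDiffeo 1 => 1 / (p.2.speed p.1 : ℝ) :=
    continuous_const.div (NNReal.continuous_coe.comp (continuous_speed_eval.comp hswap))
      fun p => (p.2.speed_pos p.1).ne'
  have hc3 : Continuous fun p : UnitAddCircle × CircleDiffeo 1 =>
      Real.exp (-s * (c * p.2.energy)) := by
    have := continuous_energy
    fun_prop
  have hfm : Measurable (Function.uncurry f) :=
    (hc1.measurable.coe_nnreal_ennreal.mul hc2.measurable.ennreal_ofReal).mul
      hc3.measurable.ennreal_ofReal
  have hfu : ∀ u, ∫⁻ φ, f u φ ∂m = ∫⁻ φ, f 0 φ ∂m := fun u => by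
    have hf0 : Measurable (f 0) := hfm.of_uncurry_left
    rw [← lintegral_rotation hm (-u) hf0]
    refine lintegral_congr fun φ => ?_
    have hR : (rotation 3 (-u)).toHomeomorph.symm 0 = u := by
      rw [Homeomorph.symm_apply_eq]
      exact (add_neg_cancel u).symm
    simp only [hf, speed_postcomp_rotation, energy_postcomp_rotation,
      symm_postcomp, hR, zero_sub, neg_neg]
  have h1 : ∫⁻ φ, f 0 φ ∂m = ∫⁻ u, ∫⁻ φ, f u φ ∂m := by
    simp only [hfu, lintegral_const, UnitAddCircle.measure_univ, mul_one]
  change ∫⁻ φ, f 0 φ ∂m = _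
  rw [h1, lintegral_lintegral_swap hfm.aemeasurable, laplaceFunctional_const,
    ← lintegral_const_mul]
  · refine lintegral_congr fun φ => ?_
    have hgc : Continuous fun u => (g u : ℝ) := NNReal.continuous_coe.comp g.continuous
    have hint : ∀ {F : UnitAddCircle → ℝ}, Continuous F → Integrable F := fun hF =>
      hF.integrable_of_hasCompactSupport (HasCompactSupport.of_compactSpace _)
    have h2 : ∫⁻ u, (g (φ.toHomeomorph.symm u) : ℝ≥0∞) * ENNReal.ofReal (1 / φ.speed u)
        = ∫⁻ u, g u := by
      have hcu : Continuous fun u => (g (φ.toHomeomorph.symm u) : ℝ) / φ.speed u :=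
        (hgc.comp φ.toHomeomorph.symm.continuous).div
          (NNReal.continuous_coe.comp φ.speed.continuous) fun u => (φ.speed_pos u).ne'
      have h3 := ofReal_integral_eq_lintegral_ofReal (hint hcu) (Eventually.of_forall fun u =>
        div_nonneg (g _).2 (φ.speed u).2)
      have h4 := ofReal_integral_eq_lintegral_ofReal (hint hgc) (Eventually.of_forall fun u =>
        (g u).2)
      rw [φ.integral_symm_div_speed hgc] at h3
      simp only [ENNReal.ofReal_coe_nnreal] at h4
      rw [← h4, h3]
      refine lintegral_congr fun u => ?_
      rw [← ENNReal.ofReal_coe_nnreal, ← ENNReal.ofReal_mul (g _).coe_nonneg, mul_one_div]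
    simp only [hf]
    rw [lintegral_mul_const', h2]
    · simp
    · exact ENNReal.ofReal_ne_top
  · have := continuous_energy
    refine Measurable.mul (by simp) (Continuous.measurable ?_).ennreal_ofReal
    fun_prop

/-- The point-interaction identity is integrated over all positive strengths. These are affine in
`cosh β`, so `sinh β dβ` is the right measure, and the exponential in `speed 0` integrates to a
multiple of `1 / speed 0`. -/
theorem lintegral_sinh_mul_laplaceFunctional [SFinite m] (hs : 0 < s) (hb₀ : 0 < b₀)
    (hm : SchwarzianQuasiInvariant s m)
    (hfin : laplaceFunctional s m 1 (fun _ => b₀ ^ 2) < ∞) (g : C(UnitAddCircle, ℝ≥0)) {b : ℝ}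
    (hb : b₀ ≤ b) :
    ∫⁻ β in Set.Ioi b, ENNReal.ofReal (Real.sinh β) *
        laplaceFunctional s m (fun u => g u) (fun _ => β ^ 2)
      = ENNReal.ofReal (Real.sinh b / (2 * s * b)) * ((∫⁻ u, g u) *
        laplaceFunctional s m 1 fun _ => b ^ 2) := by
  have hb' : 0 < b := hb₀.trans_le hb
  have hsb : 0 < Real.sinh b := Real.sinh_pos_iff.2 hb'
  have hE := continuous_energy
  have hS : Continuous fun φ : CircleDiffeo 1 => (φ.speed 0 : ℝ) := NNReal.continuous_coe.comp
    (continuous_speed_eval.comp (continuous_id.prodMk continuous_const))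
  set f : ℝ → CircleDiffeo 1 → ℝ≥0∞ := fun β φ =>
    ((g (φ.toHomeomorph.symm 0) : ℝ≥0∞) * ENNReal.ofReal (Real.exp (-s * (b ^ 2 * φ.energy)))) *
      ENNReal.ofReal (Real.sinh β * Real.exp
        (-(s * (2 * b / Real.sinh b) * φ.speed 0) * (Real.cosh β - Real.cosh b))) with hf
  have hfm : Measurable (Function.uncurry f) := by
    refine Measurable.mul ?_ (Measurable.ennreal_ofReal ?_)
    · exact (measurable_weight g (hE.const_mul (b ^ 2)|>.const_mul (-s)).measurable).comp
        measurable_snd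
    · have h1 : Measurable fun p : ℝ × CircleDiffeo 1 => (p.2.speed 0 : ℝ) :=
        hS.measurable.comp measurable_snd
      have h2 : Measurable fun p : ℝ × CircleDiffeo 1 => Real.cosh p.1 :=
        Real.measurable_cosh.comp measurable_fst
      have h3 : Measurable fun p : ℝ × CircleDiffeo 1 => Real.sinh p.1 :=
        Real.measurable_sinh.comp measurable_fst
      exact h3.mul (((h1.const_mul _).neg.mul (h2.sub_const _)).exp)
  have h1 : ∫⁻ β in Set.Ioi b, ENNReal.ofReal (Real.sinh β) *
        laplaceFunctional s m (fun u => g u) (fun _ => β ^ 2)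
      = ∫⁻ β in Set.Ioi b, ∫⁻ φ, f β φ ∂m := by
    refine setLIntegral_congr_fun measurableSet_Ioi fun β hβ => ?_
    change ENNReal.ofReal (Real.sinh β) *
        laplaceFunctional s m (fun u => g u) (fun _ => β ^ 2) = ∫⁻ φ, f β φ ∂m
    rw [laplaceFunctional_const_eq_pointInteraction hs hb₀ hm hfin g hb hβ,
      ← lintegral_const_mul' _ _ ENNReal.ofReal_ne_top]
    refine lintegral_congr fun φ => ?_
    have hsβ : 0 ≤ Real.sinh β := (Real.sinh_pos_iff.2 (hb'.trans hβ)).le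
    simp only [hf]
    rw [ENNReal.ofReal_mul hsβ, show -s * (b ^ 2 * φ.energy +
        2 * b / Real.sinh b * (Real.cosh β - Real.cosh b) * φ.speed 0)
      = -s * (b ^ 2 * φ.energy) +
        -(s * (2 * b / Real.sinh b) * φ.speed 0) * (Real.cosh β - Real.cosh b) by ring,
      Real.exp_add, ENNReal.ofReal_mul (Real.exp_pos _).le]
    ring
  rw [h1, lintegral_lintegral_swap hfm.aemeasurable, ← lintegral_div_speed hm g (b ^ 2),
    ← lintegral_const_mul' _ _ ENNReal.ofReal_ne_top]
  refine lintegral_congr fun φ => ?_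
  have hc : 0 < s * (2 * b / Real.sinh b) * (φ.speed 0 : ℝ) :=
    mul_pos (mul_pos hs (div_pos (by linarith) hsb)) (φ.speed_pos 0)
  simp only [hf]
  rw [lintegral_const_mul' _ _ (ENNReal.mul_ne_top ENNReal.coe_ne_top ENNReal.ofReal_ne_top),
    lintegral_sinh_mul_exp hc hb', show 1 / (s * (2 * b / Real.sinh b) * (φ.speed 0 : ℝ))
      = Real.sinh b / (2 * s * b) * (1 / φ.speed 0) by field_simp,
    ENNReal.ofReal_mul (by positivity)]
  ring

end

end

noncomputable section

open Filter Topology CircleDiffeo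

/-! ### The partition function -/

theorem hasDerivAt_integral_Ioi {f : ℝ → ℝ} {a b : ℝ} (hf : IntegrableOn f (Set.Ioi a))
    (hc : ContinuousOn f (Set.Ioi a)) (hb : a < b) :
    HasDerivAt (fun x => ∫ y in Set.Ioi x, f y) (-f b) b := by
  have hnhds : Set.Ioi a ∈ 𝓝 b := Ioi_mem_nhds hb
  have h1 : HasDerivAt (fun x => ∫ y in a..x, f y) (f b) b :=
    intervalIntegral.integral_hasDerivAt_right
      ((intervalIntegrable_iff_integrableOn_Ioc_of_le hb.le).2
        (hf.mono_set Set.Ioc_subset_Ioi_self))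
      (hc.stronglyMeasurableAtFilter isOpen_Ioi b hb) (hc.continuousAt hnhds)
  refine (h1.const_sub (∫ y in Set.Ioi a, f y)).congr_of_eventuallyEq ?_
  filter_upwards [hnhds] with x hx
  rw [← intervalIntegral.integral_interval_add_Ioi hf
    (hf.mono_set (Set.Ioi_subset_Ioi (le_of_lt hx))), add_sub_cancel_left]

/-- Let `F g b` be the integral of `sinh β · z g β` over `β > b`. The renewal identity gives `F g =
(∫ g) F 1`, whose derivative yields `z g = (∫ g) z 1`. It also gives `F 1 = sinh b / (2 s b) · z 1`,
so that `F 1' = -2 s b F 1` and `F 1 = A exp (-s b²)`. -/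
theorem exists_laplaceFunctional_const_eq {s : ℝ} {m : Measure (CircleDiffeo 1)} [SFinite m]
    {b₀ : ℝ} (hs : 0 < s) (hb₀ : 0 < b₀) (hm : SchwarzianQuasiInvariant s m)
    (hfin : laplaceFunctional s m 1 (fun _ => b₀ ^ 2) < ∞) :
    ∃ C : ℝ≥0, ∀ (g : C(UnitAddCircle, ℝ≥0)) (b : ℝ), b₀ < b →
      laplaceFunctional s m (fun u => g u) (fun _ => b ^ 2)
        = C * (∫⁻ u, g u) * ENNReal.ofReal (b * Real.exp (-s * b ^ 2) / Real.sinh b) := by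
  have hone : (fun u => ((1 : C(UnitAddCircle, ℝ≥0)) u : ℝ≥0∞)) = 1 := by ext u; simp
  set z : C(UnitAddCircle, ℝ≥0) → ℝ → ℝ := fun g b =>
    (laplaceFunctional s m (fun u => g u) (fun _ => b ^ 2)).toReal with hz
  have hzfin : ∀ g b, b₀ ≤ b → laplaceFunctional s m (fun u => (g : C(UnitAddCircle, ℝ≥0)) u)
      (fun _ => b ^ 2) ≠ ∞ := fun g b hb =>
    (laplaceFunctional_const_lt_top hs hb₀ hfin g hb).ne
  have hzc : ∀ g, ContinuousOn (fun b => Real.sinh b * z g b) (Set.Ioi b₀) := fun g =>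
    Real.continuous_sinh.continuousOn.mul fun b hb => ContinuousAt.continuousWithinAt <|
      (ENNReal.tendsto_toReal (hzfin g b (le_of_lt hb))).comp
        (tendsto_laplaceFunctional_const hs hb₀ hfin g
          (by filter_upwards [Ioi_mem_nhds hb] with x hx using le_of_lt hx) tendsto_id)
  have hz0 : ∀ g b, b₀ ≤ b → 0 ≤ Real.sinh b * z g b := fun g b hb =>
    mul_nonneg (Real.sinh_pos_iff.2 (hb₀.trans_le hb)).le ENNReal.toReal_nonneg
  have hgfin : ∀ g : C(UnitAddCircle, ℝ≥0), ∫⁻ u, (g u : ℝ≥0∞) ≠ ∞ := fun g => by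
    obtain ⟨C, hC⟩ := exists_forall_le_of_continuousMap g
    refine ((lintegral_mono fun u => ENNReal.coe_le_coe.2 (hC u)).trans_lt ?_).ne
    simp
  have hlin : ∀ g b, b₀ ≤ b → ∫⁻ β in Set.Ioi b, ENNReal.ofReal (Real.sinh β * z g β)
      = ENNReal.ofReal (Real.sinh b / (2 * s * b)) * ((∫⁻ u, g u) *
        laplaceFunctional s m 1 fun _ => b ^ 2) := fun g b hb => by
    rw [← lintegral_sinh_mul_laplaceFunctional hs hb₀ hm hfin g hb]
    refine setLIntegral_congr_fun measurableSet_Ioi fun β hβ => ?_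
    have hβ' : b₀ ≤ β := hb.trans (le_of_lt hβ)
    change ENNReal.ofReal (Real.sinh β * z g β) = _
    rw [ENNReal.ofReal_mul (Real.sinh_pos_iff.2 (hb₀.trans_le hβ')).le,
      ENNReal.ofReal_toReal (hzfin g β hβ')]
  have h1fin : ∀ b, b₀ ≤ b → laplaceFunctional s m 1 (fun _ => b ^ 2) ≠ ∞ := fun b hb => by
    rw [← hone]; exact hzfin 1 b hb
  have hint : ∀ g, IntegrableOn (fun β => Real.sinh β * z g β) (Set.Ioi b₀) := fun g => by
    refine ⟨(hzc g).aestronglyMeasurable measurableSet_Ioi, ?_⟩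
    rw [hasFiniteIntegral_iff_ofReal ((ae_restrict_mem measurableSet_Ioi).mono
      fun b hb => hz0 g b (le_of_lt hb)), hlin g b₀ le_rfl]
    exact ENNReal.mul_lt_top ENNReal.ofReal_lt_top
      (ENNReal.mul_lt_top (hgfin g).lt_top (h1fin b₀ le_rfl).lt_top)
  set F : C(UnitAddCircle, ℝ≥0) → ℝ → ℝ := fun g b =>
    ∫ β in Set.Ioi b, Real.sinh β * z g β with hF
  have hFeq : ∀ g b, b₀ < b →
      F g b = Real.sinh b / (2 * s * b) * ((∫⁻ u, g u).toReal * z 1 b) := fun g b hb => by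
    have hb' : 0 < b := hb₀.trans hb
    have hsb : 0 < Real.sinh b := Real.sinh_pos_iff.2 hb'
    simp only [hF]
    rw [integral_eq_lintegral_of_nonneg_ae ((ae_restrict_mem measurableSet_Ioi).mono
      fun β hβ => hz0 g β (hb.le.trans (le_of_lt hβ)))
      (((hint g).mono_set (Set.Ioi_subset_Ioi hb.le)).aestronglyMeasurable), hlin g b hb.le,
      ENNReal.toReal_mul, ENNReal.toReal_mul, ENNReal.toReal_ofReal (by positivity)]
    simp only [hz, hone]
  have hFd : ∀ g b, b₀ < b → HasDerivAt (F g) (-(Real.sinh b * z g b)) b := fun g b hb =>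
    hasDerivAt_integral_Ioi (hint g) (hzc g) hb
  have hF1 : ∀ b, b₀ < b → F 1 b = Real.sinh b / (2 * s * b) * z 1 b := fun b hb => by
    rw [hFeq 1 b hb]
    simp
  have hzg : ∀ g b, b₀ < b → z g b = (∫⁻ u, g u).toReal * z 1 b := fun g b hb => by
    have hsb : 0 < Real.sinh b := Real.sinh_pos_iff.2 (hb₀.trans hb)
    have h1 : F g =ᶠ[𝓝 b] fun x => (∫⁻ u, g u).toReal * F 1 x := by
      filter_upwards [Ioi_mem_nhds hb] with x hx
      rw [hFeq g x hx, hF1 x hx]; ring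
    have h2 := ((hFd 1 b hb).const_mul (∫⁻ u, g u).toReal).congr_of_eventuallyEq h1
    have h3 := (hFd g b hb).unique h2
    have h4 : Real.sinh b * z g b = Real.sinh b * ((∫⁻ u, g u).toReal * z 1 b) := by linarith
    exact mul_left_cancel₀ hsb.ne' h4
  have hzF : ∀ b, b₀ < b → z 1 b = 2 * s * (b / Real.sinh b) * F 1 b := fun b hb => by
    have hb' : 0 < b := hb₀.trans hb
    have hsb : 0 < Real.sinh b := Real.sinh_pos_iff.2 hb'
    rw [hF1 b hb]
    field_simp
  have hE : ∀ b, b₀ < b → HasDerivAt (fun x => F 1 x * Real.exp (s * x ^ 2)) 0 b := fun b hb => by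
    have hb' : 0 < b := hb₀.trans hb
    have hsb : 0 < Real.sinh b := Real.sinh_pos_iff.2 hb'
    have h1 := (hFd 1 b hb).mul (((hasDerivAt_pow 2 b).const_mul s).exp)
    convert! h1 using 1
    rw [hzF b hb]
    field_simp
    push_cast
    ring
  obtain ⟨A, hA⟩ := isOpen_Ioi.exists_is_const_of_deriv_eq_zero (s := Set.Ioi b₀)
    isPreconnected_Ioi (fun b hb => (hE b hb).differentiableAt.differentiableWithinAt)
    fun b hb => (hE b hb).deriv
  have hA' : ∀ b, b₀ < b → F 1 b = A * Real.exp (-s * b ^ 2) := fun b hb => by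
    rw [← hA b hb, mul_assoc, ← Real.exp_add]
    simp
  have hA0 : 0 ≤ A := by
    rw [← hA (b₀ + 1) (by simp)]
    refine mul_nonneg (setIntegral_nonneg measurableSet_Ioi fun β hβ => hz0 1 β ?_)
      (Real.exp_pos _).le
    linarith [Set.mem_Ioi.1 hβ]
  refine ⟨(2 * s * A).toNNReal, fun g b hb => ?_⟩
  have hb' : 0 < b := hb₀.trans hb
  have hsb : 0 < Real.sinh b := Real.sinh_pos_iff.2 hb'
  rw [← ENNReal.ofReal_toReal (hzfin g b hb.le)]
  change ENNReal.ofReal (z g b) = ENNReal.ofReal (2 * s * A) * _ * _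
  rw [hzg g b hb, hzF b hb, hA' b hb, ENNReal.ofReal_mul ENNReal.toReal_nonneg,
    ENNReal.ofReal_toReal (hgfin g), show 2 * s * (b / Real.sinh b) * (A * Real.exp (-s * b ^ 2))
      = 2 * s * A * (b * Real.exp (-s * b ^ 2) / Real.sinh b) by ring,
    ENNReal.ofReal_mul (by positivity)]
  ring

/-! ### Periodic solutions of the Riccati equation -/

/-- The solution operator of `f' + l f = h` on periodic functions. -/
def periodicResolvent (l : ℝ) (h : C(UnitAddCircle, ℝ)) : C(UnitAddCircle, ℝ) where
  toFun u := (Real.exp l - 1)⁻¹ * ∫ t in (0 : ℝ)..1, Real.exp (l * t) * h (u + (t : UnitAddCircle))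
  continuous_toFun := by
    refine continuous_const.mul
      (intervalIntegral.continuous_parametric_intervalIntegral_of_continuous' ?_ 0 1)
    have hc : Continuous fun p : UnitAddCircle × ℝ => p.1 + (p.2 : UnitAddCircle) :=
      continuous_fst.add ((AddCircle.continuous_mk' 1).comp continuous_snd)
    exact (Real.continuous_exp.comp (continuous_const.mul continuous_snd)).mul
      (h.continuous.comp hc)

theorem periodicResolvent_apply (l : ℝ) (h : C(UnitAddCircle, ℝ)) (u : UnitAddCircle) :
    periodicResolvent l h u = (Real.exp l - 1)⁻¹ *
      ∫ t in (0 : ℝ)..1, Real.exp (l * t) * h (u + (t : UnitAddCircle)) := rfl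

theorem continuous_resolvent_integrand (l : ℝ) (h : C(UnitAddCircle, ℝ)) (u : UnitAddCircle) :
    Continuous fun t : ℝ => Real.exp (l * t) * h (u + (t : UnitAddCircle)) :=
  (Real.continuous_exp.comp (continuous_const.mul continuous_id)).mul
    (h.continuous.comp (continuous_const.add (AddCircle.continuous_mk' 1)))

theorem periodicResolvent_const {l : ℝ} (hl : 0 < l) (c : ℝ) (u : UnitAddCircle) :
    periodicResolvent l (ContinuousMap.const _ c) u = c / l := by
  have h1 : 1 < Real.exp l := Real.one_lt_exp_iff.2 hl
  have h2 : ∫ t in (0 : ℝ)..1, Real.exp (l * t) = (Real.exp l - 1) / l := by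
    rw [intervalIntegral.integral_comp_mul_left (fun t => Real.exp t) hl.ne', integral_exp]
    simp [div_eq_inv_mul]
  have h3 : Real.exp l - 1 ≠ 0 := (sub_pos.2 h1).ne'
  simp only [periodicResolvent_apply, ContinuousMap.const_apply]
  rw [intervalIntegral.integral_mul_const, h2]
  field_simp

theorem periodicResolvent_mono {l : ℝ} (hl : 0 < l) {h₁ h₂ : C(UnitAddCircle, ℝ)}
    (h : ∀ u, h₁ u ≤ h₂ u) (u : UnitAddCircle) :
    periodicResolvent l h₁ u ≤ periodicResolvent l h₂ u := by
  have h1 : 1 < Real.exp l := Real.one_lt_exp_iff.2 hl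
  refine mul_le_mul_of_nonneg_left ?_ (inv_nonneg.2 (sub_pos.2 h1).le)
  refine intervalIntegral.integral_mono_on zero_le_one
    ((continuous_resolvent_integrand l h₁ u).intervalIntegrable _ _)
    ((continuous_resolvent_integrand l h₂ u).intervalIntegrable _ _) fun t _ => ?_
  exact mul_le_mul_of_nonneg_left (h _) (Real.exp_pos _).le

theorem periodicResolvent_sub (l : ℝ) (h₁ h₂ : C(UnitAddCircle, ℝ)) (u : UnitAddCircle) :
    periodicResolvent l (h₁ - h₂) u = periodicResolvent l h₁ u - periodicResolvent l h₂ u := by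
  simp only [periodicResolvent_apply]
  rw [← mul_sub, ← intervalIntegral.integral_sub
    ((continuous_resolvent_integrand l h₁ u).intervalIntegrable _ _)
    ((continuous_resolvent_integrand l h₂ u).intervalIntegrable _ _)]
  simp only [ContinuousMap.sub_apply, mul_sub]

theorem hasDerivAt_periodicResolvent {l : ℝ} (hl : 0 < l) (h : C(UnitAddCircle, ℝ)) (x : ℝ) :
    HasDerivAt (fun y : ℝ => periodicResolvent l h (y : UnitAddCircle))
      (h (x : UnitAddCircle) - l * periodicResolvent l h (x : UnitAddCircle)) x := by
  have h1 : 1 < Real.exp l := Real.one_lt_exp_iff.2 hl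
  have h3 : Real.exp l - 1 ≠ 0 := (sub_pos.2 h1).ne'
  set e : ℝ → ℝ := fun y => Real.exp (l * y) * h (y : UnitAddCircle) with he
  have hec : Continuous e := (Real.continuous_exp.comp (continuous_const.mul continuous_id)).mul
    (h.continuous.comp (AddCircle.continuous_mk' 1))
  have hei : ∀ a b, IntervalIntegrable e volume a b := fun a b => hec.intervalIntegrable a b
  have hE : ∀ x, HasDerivAt (fun x => ∫ y in (0 : ℝ)..x, e y) (e x) x := fun x =>
    intervalIntegral.integral_hasDerivAt_right (hei 0 x)
      (hec.stronglyMeasurableAtFilter _ _) hec.continuousAt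
  have hrep : ∀ y : ℝ, periodicResolvent l h (y : UnitAddCircle) = (Real.exp l - 1)⁻¹ *
      (Real.exp (-(l * y)) * ((∫ t in (0 : ℝ)..(y + 1), e t) - ∫ t in (0 : ℝ)..y, e t)) := by
    intro y
    rw [intervalIntegral.integral_interval_sub_left (hei _ _) (hei _ _), periodicResolvent_apply]
    congr 1
    have := intervalIntegral.integral_comp_add_left (a := 0) (b := 1) e y
    rw [add_zero] at this
    rw [← this, ← intervalIntegral.integral_const_mul]
    refine intervalIntegral.integral_congr fun t _ => ?_
    simp only [he]
    rw [← mul_assoc, ← Real.exp_add, AddCircle.coe_add]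
    congr 2
    ring
  have hd := (((((hasDerivAt_id x).const_mul l).neg).exp).mul
    (((hE (x + 1)).comp_add_const x 1).sub (hE x))).const_mul (Real.exp l - 1)⁻¹
  have hfun : (fun y : ℝ => periodicResolvent l h (y : UnitAddCircle)) = fun y =>
      (Real.exp l - 1)⁻¹ * (Real.exp (-(l * y)) *
        ((∫ t in (0 : ℝ)..(y + 1), e t) - ∫ t in (0 : ℝ)..y, e t)) := funext hrep
  rw [hfun]
  convert! hd using 1
  rw [hrep x]
  have he1 : e (x + 1) - e x = (Real.exp l - 1) * Real.exp (l * x) * h (x : UnitAddCircle) := by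
    simp only [he, AddCircle.coe_add, AddCircle.coe_period, add_zero, mul_add, mul_one,
      Real.exp_add]
    ring
  have hexp : Real.exp (-(l * x)) * Real.exp (l * x) = 1 := by
    rw [← Real.exp_add]; simp
  simp only [id, Pi.sub_apply, he1]
  field_simp
  linear_combination (-h (x : UnitAddCircle) * (Real.exp l - 1)) * hexp

/-- The equation is rewritten as `r' + 2N r = w + 2N r - r²` with `N²` an upper bound of `w`. For `b
≤ r ≤ N` the right side is nondecreasing in `r` and lies between `2N b` and `2N²`, so the monotone
periodic resolvent preserves this range. It contracts it with constant `(2N - 2b) / (2N) < 1`. -/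
theorem exists_riccati (w : C(UnitAddCircle, ℝ)) {b : ℝ} (hb : 0 < b) (hw : ∀ u, b ^ 2 ≤ w u) :
    ∃ r : ℝ → ℝ, ContDiff ℝ 1 r ∧ Function.Periodic r 1 ∧ (∀ x, b ≤ r x) ∧
      ∀ x : ℝ, w (x : UnitAddCircle) = deriv r x + r x ^ 2 := by
  obtain ⟨M, hM⟩ := (isCompact_range w.continuous).bddAbove
  have hM' : ∀ u, w u ≤ M := fun u => hM ⟨u, rfl⟩
  have hbM : b ^ 2 ≤ M := (hw 0).trans (hM' 0)
  set N : ℝ := Real.sqrt M with hN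
  have hN2 : N ^ 2 = M := Real.sq_sqrt ((sq_nonneg b).trans hbM)
  have hbN : b ≤ N := Real.le_sqrt_of_sq_le hbM
  have hN0 : 0 < N := hb.trans_le hbN
  have hl : 0 < 2 * N := by linarith
  let S : Set C(UnitAddCircle, ℝ) := {r | ∀ u, b ≤ r u ∧ r u ≤ N}
  have hS : IsComplete S := by
    refine IsClosed.isComplete ?_
    have : S = ⋂ u, {r : C(UnitAddCircle, ℝ) | b ≤ r u} ∩ {r | r u ≤ N} := by
      ext r; simp [S]
    rw [this]
    exact isClosed_iInter fun u =>
      (isClosed_le continuous_const (continuous_eval_const u)).inter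
        (isClosed_le (continuous_eval_const u) continuous_const)
  let H : C(UnitAddCircle, ℝ) → C(UnitAddCircle, ℝ) := fun r =>
    w + (ContinuousMap.const _ (2 * N)) * r - r * r
  have hH : ∀ r u, H r u = w u + 2 * N * r u - r u * r u := fun r u => rfl
  let Φ : C(UnitAddCircle, ℝ) → C(UnitAddCircle, ℝ) := fun r => periodicResolvent (2 * N) (H r)
  have hmaps : Set.MapsTo Φ S S := by
    intro r hr u
    have hc : ∀ c, c = periodicResolvent (2 * N) (ContinuousMap.const _ (2 * N * c)) u :=
      fun c => by rw [periodicResolvent_const hl]; field_simp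
    constructor
    · rw [hc b]
      refine periodicResolvent_mono hl (fun v => ?_) u
      rw [hH, ContinuousMap.const_apply]
      nlinarith [(hr v).1, (hr v).2, hw v]
    · rw [hc N]
      refine periodicResolvent_mono hl (fun v => ?_) u
      rw [hH, ContinuousMap.const_apply]
      nlinarith [(hr v).1, (hr v).2, hM' v, sq_nonneg (N - r v)]
  have hK0 : 0 ≤ 1 - b / N := sub_nonneg.2 ((div_le_one hN0).2 hbN)
  have hlip : ∀ r₁ ∈ S, ∀ r₂ ∈ S, dist (Φ r₁) (Φ r₂) ≤ (1 - b / N) * dist r₁ r₂ := by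
    intro r₁ h₁ r₂ h₂
    rw [ContinuousMap.dist_le (mul_nonneg hK0 dist_nonneg)]
    intro u
    set D := dist r₁ r₂
    have hD : ∀ v, |H r₁ v - H r₂ v| ≤ (2 * N - 2 * b) * D := by
      intro v
      have e1 : H r₁ v - H r₂ v = (2 * N - r₁ v - r₂ v) * (r₁ v - r₂ v) := by
        rw [hH, hH]; ring
      rw [e1, abs_mul]
      have e2 : |r₁ v - r₂ v| ≤ D := by
        rw [← Real.dist_eq]; exact ContinuousMap.dist_apply_le_dist v
      have e3 : |2 * N - r₁ v - r₂ v| ≤ 2 * N - 2 * b := by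
        rw [abs_of_nonneg (by linarith [(h₁ v).2, (h₂ v).2])]
        linarith [(h₁ v).1, (h₂ v).1]
      exact mul_le_mul e3 e2 (abs_nonneg _) (by linarith)
    have hq : (2 * N - 2 * b) * D / (2 * N) = (1 - b / N) * D := by field_simp
    rw [Real.dist_eq]
    change |periodicResolvent (2 * N) (H r₁) u - periodicResolvent (2 * N) (H r₂) u| ≤ _
    rw [← periodicResolvent_sub, ← hq, abs_le, ← neg_div]
    constructor
    · rw [← periodicResolvent_const hl _ u]
      exact periodicResolvent_mono hl (fun v => (abs_le.1 (hD v)).1) u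
    · rw [← periodicResolvent_const hl _ u]
      exact periodicResolvent_mono hl (fun v => (abs_le.1 (hD v)).2) u
  have hcontr : ContractingWith (1 - b / N).toNNReal (hmaps.restrict Φ S S) := by
    refine ⟨?_, LipschitzWith.of_dist_le_mul fun r₁ r₂ => ?_⟩
    · rw [Real.toNNReal_lt_one]
      linarith [div_pos hb hN0]
    · rw [Real.coe_toNNReal _ hK0]
      exact hlip r₁ r₁.2 r₂ r₂.2
  obtain ⟨r, hr, hfix, -⟩ := hcontr.exists_fixedPoint' hS hmaps
    (x := ContinuousMap.const _ b) (fun u => ⟨le_rfl, hbN⟩) (edist_ne_top _ _)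
  have hfix' : periodicResolvent (2 * N) (H r) = r := hfix
  have hder : ∀ x : ℝ, HasDerivAt (fun y : ℝ => r (y : UnitAddCircle))
      (w (x : UnitAddCircle) - r (x : UnitAddCircle) ^ 2) x := fun x => by
    have := hasDerivAt_periodicResolvent hl (H r) x
    rw [hfix', hH] at this
    convert! this using 1
    ring
  refine ⟨fun x => r (x : UnitAddCircle), ?_, fun x => ?_, fun x => (hr _).1, fun x => ?_⟩
  · have hcont : Continuous fun x : ℝ => w (x : UnitAddCircle) - r (x : UnitAddCircle) ^ 2 :=
      (w.continuous.comp (AddCircle.continuous_mk' 1)).sub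
        ((r.continuous.comp (AddCircle.continuous_mk' 1)).pow 2)
    exact_mod_cast ContDiff.of_hasDerivAt (n := 0) hder (contDiff_zero.2 hcont)
  · simp only [AddCircle.coe_add, AddCircle.coe_period, add_zero]
  · rw [(hder x).deriv]; ring

end

noncomputable section

open Filter Topology CircleDiffeo

/-! ### Measures determined by their Laplace functional -/

instance : MeasurableSpace C(UnitAddCircle, ℝ≥0) := borel _

instance : BorelSpace C(UnitAddCircle, ℝ≥0) := ⟨rfl⟩

theorem circlePairing_nonneg {v : UnitAddCircle → ℝ} (hv : ∀ u, 0 ≤ v u)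
    (q : C(UnitAddCircle, ℝ≥0)) : 0 ≤ circlePairing v q :=
  integral_nonneg fun u => mul_nonneg (hv u) (q u).coe_nonneg

theorem integrable_mul_continuousMap {v : UnitAddCircle → ℝ} (hv : Continuous v)
    (q : C(UnitAddCircle, ℝ≥0)) : Integrable fun u => v u * (q u : ℝ) :=
  (hv.mul (NNReal.continuous_coe.comp q.continuous)).integrable_of_hasCompactSupport
    (HasCompactSupport.of_compactSpace _)

theorem circlePairing_add {v₁ v₂ : UnitAddCircle → ℝ} (h₁ : Continuous v₁) (h₂ : Continuous v₂)
    (q : C(UnitAddCircle, ℝ≥0)) :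
    circlePairing (fun u => v₁ u + v₂ u) q = circlePairing v₁ q + circlePairing v₂ q := by
  simp only [circlePairing]
  rw [← integral_add (integrable_mul_continuousMap h₁ q) (integrable_mul_continuousMap h₂ q)]
  simp only [add_mul]

/-- The positive part of the difference of the two functions, taken in the order where it is
nonzero, separates them. A nonnegative test function is needed so that the exponentials built from
it are bounded. -/
theorem exists_circlePairing_ne {q₁ q₂ : C(UnitAddCircle, ℝ≥0)} (h : q₁ ≠ q₂) :
    ∃ v : C(UnitAddCircle, ℝ), (∀ u, 0 ≤ v u) ∧ circlePairing v q₁ ≠ circlePairing v q₂ := by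
  have key : ∀ q₁ q₂ : C(UnitAddCircle, ℝ≥0), ∀ u₀, q₁ u₀ < q₂ u₀ →
      ∃ v : C(UnitAddCircle, ℝ), (∀ u, 0 ≤ v u) ∧ circlePairing v q₁ ≠ circlePairing v q₂ := by
    intro q₁ q₂ u₀ hu₀
    have hc₁ : Continuous fun u => (q₁ u : ℝ) := NNReal.continuous_coe.comp q₁.continuous
    have hc₂ : Continuous fun u => (q₂ u : ℝ) := NNReal.continuous_coe.comp q₂.continuous
    let v : C(UnitAddCircle, ℝ) :=
      ⟨fun u => max ((q₂ u : ℝ) - q₁ u) 0, (hc₂.sub hc₁).max continuous_const⟩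
    have hvdef : ∀ u, v u = max ((q₂ u : ℝ) - q₁ u) 0 := fun u => rfl
    refine ⟨v, fun u => le_max_right _ _, fun heq => ?_⟩
    have hpos : 0 < ∫ u, v u ^ 2 := by
      refine (v.continuous.pow 2).integral_pos_of_hasCompactSupport_nonneg_nonzero
        (HasCompactSupport.of_compactSpace _) (fun u => sq_nonneg (v u)) (x := u₀) ?_
      have : 0 < v u₀ := lt_max_of_lt_left (sub_pos.2 (NNReal.coe_lt_coe.2 hu₀))
      exact pow_ne_zero 2 this.ne'
    have h0 : circlePairing v q₂ - circlePairing v q₁ = ∫ u, v u ^ 2 := by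
      simp only [circlePairing]
      rw [← integral_sub (integrable_mul_continuousMap v.continuous q₂)
        (integrable_mul_continuousMap v.continuous q₁)]
      refine integral_congr_ae (Eventually.of_forall fun u => ?_)
      simp only [hvdef]
      rcases le_total ((q₂ u : ℝ) - q₁ u) 0 with h | h
      · rw [max_eq_right h]; simp
      · rw [max_eq_left h]; ring
    rw [heq, sub_self] at h0
    exact hpos.ne h0
  obtain ⟨u₀, hu₀⟩ : ∃ u, q₁ u ≠ q₂ u := by
    by_contra hcon
    push Not at hcon
    exact h (ContinuousMap.ext hcon)
  rcases lt_or_gt_of_ne hu₀ with h | h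
  · exact key q₁ q₂ u₀ h
  · obtain ⟨v, hv, hne⟩ := key q₂ q₁ u₀ h
    exact ⟨v, hv, hne.symm⟩

open scoped BoundedContinuousFunction in
-- The functions `g(x) exp (-s ⟨v, q⟩)` are closed under products, so their span is an algebra of
-- bounded continuous functions. It separates points, and on a complete separable metric space such
-- an algebra determines finite measures.
theorem ext_of_lintegral_exp_circlePairing {s : ℝ} (hs : 0 < s)
    {P Q : Measure (UnitAddCircle × C(UnitAddCircle, ℝ≥0))} [IsFiniteMeasure P] [IsFiniteMeasure Q]
    (h : ∀ (g : C(UnitAddCircle, ℝ≥0)) (v : C(UnitAddCircle, ℝ)), (∀ u, 0 ≤ v u) →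
      ∫⁻ x, (g x.1 : ℝ≥0∞) * ENNReal.ofReal (Real.exp (-s * circlePairing v x.2)) ∂P
        = ∫⁻ x, (g x.1 : ℝ≥0∞) * ENNReal.ofReal (Real.exp (-s * circlePairing v x.2)) ∂Q) :
    P = Q := by
  let X := UnitAddCircle × C(UnitAddCircle, ℝ≥0)
  let M : Submonoid (X →ᵇ ℝ) :=
    { carrier := {f | ∃ (g : C(UnitAddCircle, ℝ≥0)) (v : C(UnitAddCircle, ℝ)), (∀ u, 0 ≤ v u) ∧
        ∀ x, f x = g x.1 * Real.exp (-s * circlePairing v x.2)}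
      one_mem' := ⟨1, 0, fun u => le_rfl, fun x => by simp [circlePairing]⟩
      mul_mem' := by
        rintro f₁ f₂ ⟨g₁, v₁, hv₁, h₁⟩ ⟨g₂, v₂, hv₂, h₂⟩
        refine ⟨g₁ * g₂, v₁ + v₂, fun u => add_nonneg (hv₁ u) (hv₂ u), fun x => ?_⟩
        have := circlePairing_add v₁.continuous v₂.continuous x.2
        change circlePairing (v₁ + v₂ : C(UnitAddCircle, ℝ)) x.2 = _ at this
        rw [BoundedContinuousFunction.mul_apply, h₁, h₂, this, mul_add, Real.exp_add]
        simp only [ContinuousMap.mul_apply, NNReal.coe_mul]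
        ring }
  have hmem : ∀ (g : C(UnitAddCircle, ℝ≥0)) (v : C(UnitAddCircle, ℝ)), (∀ u, 0 ≤ v u) →
      ∃ f ∈ M, ∀ x : X, f x = g x.1 * Real.exp (-s * circlePairing v x.2) := by
    intro g v hv
    obtain ⟨C, hC⟩ := exists_forall_le_of_continuousMap g
    have hcont : Continuous fun x : X => (g x.1 : ℝ) * Real.exp (-s * circlePairing v x.2) :=
      (NNReal.continuous_coe.comp (g.continuous.comp continuous_fst)).mul
        (Real.continuous_exp.comp (continuous_const.mul
          ((continuous_circlePairing v.continuous).comp continuous_snd)))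
    refine ⟨BoundedContinuousFunction.ofNormedAddCommGroup _ hcont C fun x => ?_,
      ⟨g, v, hv, fun x => rfl⟩, fun x => rfl⟩
    rw [Real.norm_of_nonneg (mul_nonneg (g _).coe_nonneg (Real.exp_pos _).le)]
    have h1 : Real.exp (-s * circlePairing v x.2) ≤ 1 := by
      rw [Real.exp_le_one_iff]
      nlinarith [circlePairing_nonneg hv x.2]
    calc (g x.1 : ℝ) * Real.exp (-s * circlePairing v x.2) ≤ (g x.1 : ℝ) * 1 :=
          mul_le_mul_of_nonneg_left h1 (g _).coe_nonneg
      _ ≤ C := by rw [mul_one]; exact NNReal.coe_le_coe.2 (hC _)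
  have hint : ∀ (R : Measure X) [IsFiniteMeasure R] (f : X →ᵇ ℝ), Integrable f R :=
    fun R _ f => f.integrable R
  have hM : ∀ f ∈ M, ∫ x, f x ∂P = ∫ x, f x ∂Q := by
    rintro f ⟨g, v, hv, hf⟩
    have hf0 : ∀ x, 0 ≤ f x := fun x => by
      rw [hf]; exact mul_nonneg (g _).coe_nonneg (Real.exp_pos _).le
    have hfo : ∀ x, ENNReal.ofReal (f x)
        = (g x.1 : ℝ≥0∞) * ENNReal.ofReal (Real.exp (-s * circlePairing v x.2)) := fun x => by
      rw [hf, ENNReal.ofReal_mul (g _).coe_nonneg, ENNReal.ofReal_coe_nnreal]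
    rw [integral_eq_lintegral_of_nonneg_ae (Eventually.of_forall hf0)
      (hint P f).aestronglyMeasurable, integral_eq_lintegral_of_nonneg_ae
      (Eventually.of_forall hf0) (hint Q f).aestronglyMeasurable]
    simp only [hfo]
    rw [h g v hv]
  let A : StarSubalgebra ℝ (X →ᵇ ℝ) :=
    { Algebra.adjoin ℝ (M : Set (X →ᵇ ℝ)) with
      star_mem' := fun {f} hf => by rwa [show star f = f from by ext; simp] }
  have hMA : ∀ f ∈ M, f ∈ A := fun f hf => Algebra.subset_adjoin hf
  refine ext_of_forall_mem_subalgebra_integral_eq_of_pseudoEMetric_complete_countable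
    (𝕜 := ℝ) (A := A) ?_ fun f hf => ?_
  · intro x y hxy
    have hsep : ∃ (g : C(UnitAddCircle, ℝ≥0)) (v : C(UnitAddCircle, ℝ)), (∀ u, 0 ≤ v u) ∧
        (g x.1 : ℝ) * Real.exp (-s * circlePairing v x.2)
          ≠ g y.1 * Real.exp (-s * circlePairing v y.2) := by
      by_cases h1 : x.1 = y.1
      · obtain ⟨v, hv, hne⟩ := exists_circlePairing_ne fun h2 => hxy (Prod.ext h1 h2)
        refine ⟨1, v, hv, ?_⟩
        simpa [hs.ne'] using hne
      · refine ⟨⟨fun u => nndist u x.1, by fun_prop⟩, 0, fun u => le_rfl, ?_⟩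
        simpa [circlePairing, eq_comm] using h1
    obtain ⟨g, v, hv, hne⟩ := hsep
    obtain ⟨f, hf, hfx⟩ := hmem g v hv
    refine ⟨f, ⟨f.toContinuousMap, ⟨f, hMA f hf, rfl⟩, rfl⟩, ?_⟩
    rwa [hfx, hfx]
  · have hf' : f ∈ Submodule.span ℝ (M : Set (X →ᵇ ℝ)) := by
      have h1 : f ∈ Subalgebra.toSubmodule (Algebra.adjoin ℝ (M : Set (X →ᵇ ℝ))) := hf
      rwa [Algebra.adjoin_eq_span, Submonoid.closure_eq] at h1
    clear hf
    induction hf' using Submodule.span_induction with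
    | mem f hf => exact hM f hf
    | zero => simp
    | add f₁ f₂ _ _ h₁ h₂ =>
      simp only [BoundedContinuousFunction.coe_add, Pi.add_apply]
      rw [integral_add (hint P f₁) (hint P f₂), integral_add (hint Q f₁) (hint Q f₂), h₁, h₂]
    | smul c f _ h₁ =>
      simp only [BoundedContinuousFunction.coe_smul, smul_eq_mul]
      rw [integral_const_mul, integral_const_mul, h₁]

/-- The root and the speed of a diffeomorphism. -/
def rootSpeed (φ : CircleDiffeo 1) : UnitAddCircle × C(UnitAddCircle, ℝ≥0) :=
  (φ.toHomeomorph.symm 0, φ.speed)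

theorem continuous_rootSpeed : Continuous rootSpeed :=
  continuous_symm_zero.prodMk continuous_speed

theorem rootSpeed_injective : Function.Injective rootSpeed := fun _ _ h =>
  eq_of_symm_zero_eq_of_speed_eq (congrArg Prod.fst h) (congrArg Prod.snd h)

/-- Inner regular measures on `Diff¹(𝕋)` are determined by the Laplace functional of a finite
reweighting. -/
theorem eq_of_laplaceFunctional_withDensity_eq {s c : ℝ} (hs : 0 < s)
    {μ ν : Measure (CircleDiffeo 1)} (hμ : μ.InnerRegular) (hν : ν.InnerRegular)
    (hfin : μ.withDensity (fun φ => ENNReal.ofReal (Real.exp (c * φ.energy))) Set.univ < ∞)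
    (h : ∀ (g : C(UnitAddCircle, ℝ≥0)) (v : C(UnitAddCircle, ℝ)), (∀ u, 0 ≤ v u) →
      laplaceFunctional s (μ.withDensity fun φ => ENNReal.ofReal (Real.exp (c * φ.energy)))
          (fun u => g u) v
        = laplaceFunctional s (ν.withDensity fun φ => ENNReal.ofReal (Real.exp (c * φ.energy)))
          (fun u => g u) v) : μ = ν := by
  set ρ : CircleDiffeo 1 → ℝ≥0∞ := fun φ => ENNReal.ofReal (Real.exp (c * φ.energy)) with hρ
  have hρm : Measurable ρ :=
    (Real.continuous_exp.comp (continuous_const.mul continuous_energy)).measurable.ennreal_ofReal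
  have hΦ := continuous_rootSpeed.measurable
  have huniv : ∀ m : Measure (CircleDiffeo 1),
      laplaceFunctional s m (fun u => (1 : C(UnitAddCircle, ℝ≥0)) u) (0 : C(UnitAddCircle, ℝ))
        = m Set.univ := fun m => by
    simp [laplaceFunctional, speedPairing]
  have hfin' : ν.withDensity ρ Set.univ < ∞ := by
    rw [← huniv, ← h 1 0 fun u => le_rfl, huniv]
    exact hfin
  have : IsFiniteMeasure (μ.withDensity ρ) := ⟨hfin⟩
  have : IsFiniteMeasure (ν.withDensity ρ) := ⟨hfin'⟩
  have hmap : (μ.withDensity ρ).map rootSpeed = (ν.withDensity ρ).map rootSpeed := by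
    refine ext_of_lintegral_exp_circlePairing hs fun g v hv => ?_
    have hmeas : Measurable fun x : UnitAddCircle × C(UnitAddCircle, ℝ≥0) =>
        (g x.1 : ℝ≥0∞) * ENNReal.ofReal (Real.exp (-s * circlePairing v x.2)) :=
      (g.continuous.comp continuous_fst).measurable.coe_nnreal_ennreal.mul
        (Real.continuous_exp.comp (continuous_const.mul
          ((continuous_circlePairing v.continuous).comp continuous_snd))).measurable.ennreal_ofReal
    rw [lintegral_map hmeas hΦ, lintegral_map hmeas hΦ]
    exact h g v hv
  -- A compact `K` has compact, hence Borel, image, and injectivity recovers `K` as its preimage.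
  -- The weight depends only on the speed, so it can be divided out on the target by `κ`; inner
  -- regularity then passes from compact sets to all Borel sets.
  have hK : ∀ K : Set (CircleDiffeo 1), IsCompact K → μ K = ν K := by
    intro K hKc
    have hpre : rootSpeed ⁻¹' (rootSpeed '' K) = K :=
      Set.preimage_image_eq K rootSpeed_injective
    have hKX : MeasurableSet (rootSpeed '' K) :=
      (hKc.image continuous_rootSpeed).isClosed.measurableSet
    have hKm : MeasurableSet K := hpre ▸ hΦ hKX
    set κ : UnitAddCircle × C(UnitAddCircle, ℝ≥0) → ℝ≥0∞ := fun x =>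
      ENNReal.ofReal (Real.exp (-(c * circlePairing (fun _ => 1) x.2))) with hκ
    have hκm : Measurable κ := (Real.continuous_exp.comp (continuous_const.mul
      ((continuous_circlePairing continuous_const).comp
        continuous_snd)).neg).measurable.ennreal_ofReal
    have hval : ∀ m : Measure (CircleDiffeo 1),
        m K = ∫⁻ x in rootSpeed '' K, κ x ∂((m.withDensity ρ).map rootSpeed) := by
      intro m
      have hκΦ : Measurable fun φ => κ (rootSpeed φ) := hκm.comp hΦ
      rw [setLIntegral_map hKX hκm hΦ, hpre, setLIntegral_withDensity_eq_setLIntegral_mul _ hρm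
        hκΦ hKm]
      have h1 : ∀ φ, (ρ * fun φ => κ (rootSpeed φ)) φ = 1 := fun φ => by
        have hE : circlePairing (fun _ => 1) (rootSpeed φ).2 = φ.energy := by
          have := speedPairing_const 1 φ
          rw [one_mul] at this
          exact this
        simp only [Pi.mul_apply, hρ, hκ, hE]
        rw [← ENNReal.ofReal_mul (Real.exp_pos _).le, ← Real.exp_add]
        simp
      simp only [h1, lintegral_one, Measure.restrict_apply_univ]
    rw [hval μ, hval ν, hmap]
  have hle : ∀ μ ν : Measure (CircleDiffeo 1), μ.InnerRegular →
      (∀ K, IsCompact K → μ K ≤ ν K) → μ ≤ ν := by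
    intro μ ν hμ hK
    refine Measure.le_iff.2 fun A hA => ?_
    rw [hA.measure_eq_iSup_isCompact]
    exact iSup₂_le fun K hKA => iSup_le fun hKc => (hK K hKc).trans (measure_mono hKA)
  exact le_antisymm (hle μ ν hμ fun K h1 => (hK K h1).le) (hle ν μ hν fun K h1 => (hK K h1).ge)

end

noncomputable section

open Filter Topology CircleDiffeo

/-! ### Orbital measures -/

section

variable {σ αsq : ℝ} {μ : Measure (CircleDiffeo 1)}

theorem measurable_exp_energy (c : ℝ) :
    Measurable fun φ : CircleDiffeo 1 => ENNReal.ofReal (Real.exp (c * φ.energy)) :=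
  (Real.continuous_exp.comp (continuous_const.mul continuous_energy)).measurable.ennreal_ofReal

/-- The `α`-part of the exponent is a coboundary, the change of energy under `ψ`, and so can be
absorbed into a reweighting. -/
theorem orbitalDensity_eq (σ αsq : ℝ) (ψ : CircleDiffeo 3) (φ : CircleDiffeo 1) :
    orbitalDensity σ αsq ψ φ = Real.exp (1 / σ ^ 2 * (speedPairing ψ.schwarzian φ
      + 2 * αsq * ((ψ.postcomp φ).energy - φ.energy))) := by
  have hd : Continuous fun u => ψ.derivative u ^ 2 :=
    (continuous_derivative_of_one_le (by norm_num) ψ).pow 2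
  have hw : Continuous fun u => ψ.schwarzian u + 2 * αsq * (ψ.derivative u ^ 2 - 1) :=
    (continuous_schwarzian ψ).add (continuous_const.mul (hd.sub continuous_const))
  rw [orbitalDensity, ← φ.integral_mul_speed hw, energy_postcomp, energy_eq, speedPairing]
  have h1 : Integrable fun u => (φ.speed u : ℝ) := by
    simpa using integrable_mul_speed (w := fun _ => 1) continuous_const φ
  have h2 : Integrable fun u => 2 * αsq * (ψ.derivative u ^ 2 * φ.speed u - φ.speed u) :=
    ((integrable_mul_speed hd φ).sub h1).const_mul _
  rw [← integral_sub (integrable_mul_speed hd φ) h1, ← integral_const_mul (2 * αsq),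
    ← integral_add (integrable_mul_speed (continuous_schwarzian ψ) φ) h2]
  congr 3
  ext u
  ring

theorem continuous_orbitalDensity (σ αsq : ℝ) (ψ : CircleDiffeo 3) :
    Continuous (orbitalDensity σ αsq ψ) := by
  have h1 := continuous_speedPairing (continuous_schwarzian ψ)
  have h2 := continuous_energy.comp (continuous_postcomp ψ)
  have h3 := continuous_energy
  rw [show orbitalDensity σ αsq ψ = _ from funext (orbitalDensity_eq σ αsq ψ)]
  exact Real.continuous_exp.comp (continuous_const.mul (h1.add (continuous_const.mul (h2.sub h3))))

theorem IsOrbitalMeasure.lintegral_postcomp (hμ : IsOrbitalMeasure σ αsq μ) (ψ : CircleDiffeo 3)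
    {f : CircleDiffeo 1 → ℝ≥0∞} (hf : Measurable f) :
    ∫⁻ φ, ENNReal.ofReal (orbitalDensity σ αsq ψ φ) * f (ψ.postcomp φ) ∂μ = ∫⁻ φ, f φ ∂μ := by
  have hψ := (continuous_postcomp ψ).measurable
  have hmap : (μ.withDensity fun φ => ENNReal.ofReal (orbitalDensity σ αsq ψ φ)).map ψ.postcomp
      = μ := by
    refine Measure.ext fun B hB => ?_
    rw [Measure.map_apply hψ hB, withDensity_apply _ (hψ hB),
      ← hμ.change_of_variables ψ _ (hψ hB), Set.image_preimage_eq B ψ.postcomp_surjective]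
  have hd : Measurable fun φ => ENNReal.ofReal (orbitalDensity σ αsq ψ φ) :=
    (continuous_orbitalDensity σ αsq ψ).measurable.ennreal_ofReal
  have hfψ : Measurable fun φ => f (ψ.postcomp φ) := hf.comp hψ
  conv_rhs => rw [← hmap]
  rw [lintegral_map hf hψ, lintegral_withDensity_eq_lintegral_mul _ hd hfψ]
  rfl

/-- The weight with parameter `0` cancels the energy coboundary exactly, whatever the sign of `α²`.
All later analysis takes place with a cocycle free of `α`. -/
theorem IsOrbitalMeasure.schwarzianQuasiInvariant (hμ : IsOrbitalMeasure σ αsq μ) :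
    SchwarzianQuasiInvariant (2 / σ ^ 2) (reweight σ αsq 0 μ) := by
  intro ψ f hf
  have hρ := measurable_exp_energy (2 * (0 - αsq) / σ ^ 2)
  have hψ := (continuous_postcomp ψ).measurable
  have hS : Measurable fun φ : CircleDiffeo 1 =>
      ENNReal.ofReal (Real.exp (2 / σ ^ 2 / 2 * speedPairing ψ.schwarzian φ)) :=
    (Real.continuous_exp.comp (continuous_const.mul
      (continuous_speedPairing (continuous_schwarzian ψ)))).measurable.ennreal_ofReal
  have hL : Measurable fun φ => f (ψ.postcomp φ) *
      ENNReal.ofReal (Real.exp (2 / σ ^ 2 / 2 * speedPairing ψ.schwarzian φ)) :=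
    (hf.comp hψ).mul hS
  rw [reweight, lintegral_withDensity_eq_lintegral_mul _ hρ hL,
    lintegral_withDensity_eq_lintegral_mul _ hρ hf, ← hμ.lintegral_postcomp ψ (hρ.mul hf)]
  refine lintegral_congr fun φ => ?_
  simp only [Pi.mul_apply]
  rw [orbitalDensity_eq, mul_comm (f _), ← mul_assoc, ← mul_assoc,
    ← ENNReal.ofReal_mul (Real.exp_pos _).le, ← ENNReal.ofReal_mul (Real.exp_pos _).le,
    ← Real.exp_add, ← Real.exp_add]
  congr 3
  ring

theorem reweight_eq_withDensity (σ αsq β₁ β₂ : ℝ) (μ : Measure (CircleDiffeo 1)) :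
    reweight σ αsq β₁ μ = (reweight σ αsq β₂ μ).withDensity
      fun φ => ENNReal.ofReal (Real.exp (2 * (β₁ - β₂) / σ ^ 2 * φ.energy)) := by
  rw [reweight, reweight, ← withDensity_mul _ (measurable_exp_energy _) (measurable_exp_energy _)]
  congr 1
  ext φ
  rw [Pi.mul_apply, ← ENNReal.ofReal_mul (Real.exp_pos _).le, ← Real.exp_add]
  congr 2
  ring

theorem laplaceFunctional_reweight (b : ℝ) (μ : Measure (CircleDiffeo 1))
    {g : UnitAddCircle → ℝ≥0∞} (hg : Measurable g) {v : UnitAddCircle → ℝ} (hv : Continuous v) :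
    laplaceFunctional (2 / σ ^ 2) (reweight σ αsq (-b ^ 2) μ) g v
      = laplaceFunctional (2 / σ ^ 2) (reweight σ αsq 0 μ) g fun u => b ^ 2 + v u := by
  have hm : Measurable fun φ : CircleDiffeo 1 => g (φ.toHomeomorph.symm 0) *
      ENNReal.ofReal (Real.exp (-(2 / σ ^ 2) * speedPairing v φ)) :=
    (hg.comp continuous_symm_zero.measurable).mul (Real.continuous_exp.comp
      (continuous_const.mul (continuous_speedPairing hv))).measurable.ennreal_ofReal
  rw [reweight_eq_withDensity σ αsq (-b ^ 2) 0, laplaceFunctional,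
    lintegral_withDensity_eq_lintegral_mul _ (measurable_exp_energy _) hm]
  refine lintegral_congr fun φ => ?_
  have h1 : speedPairing (fun u => b ^ 2 + v u) φ = b ^ 2 * φ.energy + speedPairing v φ := by
    rw [← speedPairing_const]
    exact circlePairing_add continuous_const hv φ.speed
  rw [Pi.mul_apply, mul_left_comm, ← ENNReal.ofReal_mul (Real.exp_pos _).le, ← Real.exp_add, h1]
  congr 3
  ring

theorem laplaceFunctional_one_zero (s : ℝ) (m : Measure (CircleDiffeo 1)) :
    laplaceFunctional s m 1 (fun _ => 0) = m Set.univ := by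
  simp [laplaceFunctional, speedPairing]

theorem reweight_univ_mono (σ αsq : ℝ) {β₁ β₂ : ℝ} (h : β₁ ≤ β₂) (μ : Measure (CircleDiffeo 1)) :
    reweight σ αsq β₁ μ Set.univ ≤ reweight σ αsq β₂ μ Set.univ := by
  simp only [reweight, withDensity_apply _ MeasurableSet.univ]
  refine lintegral_mono fun φ => ENNReal.ofReal_le_ofReal (Real.exp_le_exp.2 ?_)
  have := φ.energy_nonneg
  gcongr

/-- The Laplace functional of a regular orbital measure is explicit up to a constant. -/
theorem IsOrbitalMeasure.exists_laplaceFunctional_eq (hσ : 0 < σ) (hμ : IsOrbitalMeasure σ αsq μ)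
    {b₀ : ℝ} (hb₀ : 0 < b₀) (hfin : reweight σ αsq (-b₀ ^ 2) μ Set.univ < ∞) :
    ∃ C : ℝ≥0, ∀ (g : C(UnitAddCircle, ℝ≥0)) (b : ℝ), b₀ < b → ∀ r : ℝ → ℝ, ContDiff ℝ 1 r →
      Function.Periodic r 1 → (∀ x, b ≤ r x) → ∀ v : C(UnitAddCircle, ℝ),
      (∀ x : ℝ, b ^ 2 + v (x : UnitAddCircle) = deriv r x + r x ^ 2) →
      laplaceFunctional (2 / σ ^ 2) (reweight σ αsq (-b ^ 2) μ) (fun u => g u) v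
        = C * (∫⁻ u, g u) * ENNReal.ofReal ((∫ x in (0 : ℝ)..1, r x) *
          Real.exp (-(2 / σ ^ 2) * (∫ x in (0 : ℝ)..1, r x) ^ 2) /
            Real.sinh (∫ x in (0 : ℝ)..1, r x)) := by
  have hs : 0 < 2 / σ ^ 2 := by positivity
  have hfin' : laplaceFunctional (2 / σ ^ 2) (reweight σ αsq 0 μ) 1 (fun _ => b₀ ^ 2) < ∞ := by
    have := laplaceFunctional_reweight (σ := σ) (αsq := αsq) b₀ μ (g := 1) measurable_const
      (v := fun _ => 0) continuous_const
    rw [laplaceFunctional_one_zero] at this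
    simp only [add_zero] at this
    rwa [← this]
  have : IsFiniteMeasure (reweight σ αsq (-b₀ ^ 2) μ) := ⟨hfin⟩
  -- This measure may be infinite, but it is a finite measure times a density, which suffices for
  -- the Tonelli exchanges.
  have : SFinite (reweight σ αsq 0 μ) := by
    rw [reweight_eq_withDensity σ αsq 0 (-b₀ ^ 2)]
    infer_instance
  obtain ⟨C, hC⟩ := exists_laplaceFunctional_const_eq hs hb₀ hμ.schwarzianQuasiInvariant hfin'
  refine ⟨C, fun g b hb r hr hp hbr v hv => ?_⟩
  have hβ : b₀ < ∫ x in (0 : ℝ)..1, r x := by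
    have h1 : ∫ _ in (0 : ℝ)..1, b ≤ ∫ x in (0 : ℝ)..1, r x :=
      intervalIntegral.integral_mono_on zero_le_one intervalIntegrable_const
        (hr.continuous.intervalIntegrable _ _) fun x _ => hbr x
    simp only [intervalIntegral.integral_const, sub_zero, one_smul] at h1
    exact hb.trans_le h1
  have hg := g.continuous.measurable.coe_nnreal_ennreal
  rw [laplaceFunctional_reweight b μ hg v.continuous, ← hC g _ hβ]
  exact hμ.schwarzianQuasiInvariant.laplaceFunctional_riccati hg hr hp rfl (hb₀.trans hβ) hv

/-- The energy is nonnegative, so lowering the parameter preserves finiteness, and `b ≥ 1 + |βsq|`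
forces `-b² ≤ βsq`. -/
theorem IsRegularOrbitalMeasure.exists_forall_finite (hμ : IsRegularOrbitalMeasure σ αsq μ) :
    ∃ B : ℝ, 0 < B ∧ ∀ b, B ≤ b → reweight σ αsq (-b ^ 2) μ Set.univ < ∞ := by
  obtain ⟨βsq, hβ⟩ := hμ.exists_finite
  refine ⟨1 + |βsq|, by positivity, fun b hb => (reweight_univ_mono σ αsq ?_ μ).trans_lt hβ⟩
  have h1 := neg_abs_le βsq
  nlinarith [abs_nonneg βsq]

theorem laplaceFunctional_smul_measure (s : ℝ) (c : ℝ≥0) (m : Measure (CircleDiffeo 1))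
    (g : UnitAddCircle → ℝ≥0∞) (w : UnitAddCircle → ℝ) :
    laplaceFunctional s (c • m) g w = c * laplaceFunctional s m g w := by
  rw [laplaceFunctional, laplaceFunctional, lintegral_smul_measure, ENNReal.smul_def, smul_eq_mul]

theorem reweight_smul (σ αsq βsq : ℝ) (c : ℝ≥0) (μ : Measure (CircleDiffeo 1)) :
    reweight σ αsq βsq (c • μ) = c • reweight σ αsq βsq μ := by
  exact withDensity_smul_measure (c : ℝ≥0∞) _

theorem reweight_univ_eq_zero {βsq : ℝ} (h : reweight σ αsq βsq μ Set.univ = 0) : μ = 0 := by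
  rw [Measure.measure_univ_eq_zero, reweight, withDensity_eq_zero_iff
    (measurable_exp_energy _).aemeasurable] at h
  rw [← ae_eq_bot, ← Filter.empty_mem_iff_bot]
  filter_upwards [h] with φ hφ
  simp only [Pi.zero_apply, ENNReal.ofReal_eq_zero] at hφ
  exact absurd hφ (not_le.2 (Real.exp_pos _))

/-- Both Laplace functionals are the same explicit functional, multiplied by `C₁` and `C₂`
respectively; the ratio `C₂ / C₁` is the required constant. -/
theorem IsRegularOrbitalMeasure.unique (hσ : 0 < σ) {ν : Measure (CircleDiffeo 1)}
    (hμ : IsRegularOrbitalMeasure σ αsq μ) (hν : IsRegularOrbitalMeasure σ αsq ν) (h0 : μ ≠ 0) :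
    ∃ c : ℝ≥0, ν = c • μ := by
  have hs : 0 < 2 / σ ^ 2 := by positivity
  obtain ⟨B₁, hB₁, hfin₁⟩ := hμ.exists_forall_finite
  obtain ⟨B₂, hB₂, hfin₂⟩ := hν.exists_forall_finite
  set b₀ := max B₁ B₂
  have hb₀ : 0 < b₀ := hB₁.trans_le (le_max_left _ _)
  obtain ⟨C₁, hC₁⟩ := hμ.orbital.exists_laplaceFunctional_eq hσ hb₀ (hfin₁ b₀ (le_max_left _ _))
  obtain ⟨C₂, hC₂⟩ := hν.orbital.exists_laplaceFunctional_eq hσ hb₀ (hfin₂ b₀ (le_max_right _ _))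
  -- The explicit formula holds only strictly above `b₀`, where the renewal identity can be
  -- differentiated.
  set b := b₀ + 1
  have hb : b₀ < b := lt_add_one b₀
  have hric : ∀ v : C(UnitAddCircle, ℝ), (∀ u, 0 ≤ v u) → ∃ r : ℝ → ℝ, ContDiff ℝ 1 r ∧
      Function.Periodic r 1 ∧ (∀ x, b ≤ r x) ∧
      ∀ x : ℝ, b ^ 2 + v (x : UnitAddCircle) = deriv r x + r x ^ 2 := fun v hv =>
    exists_riccati (ContinuousMap.const _ (b ^ 2) + v) (hb₀.trans hb)
      fun u => le_add_of_nonneg_right (hv u)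
  -- With `g = 1` and `v = 0` the functional is the total mass of a reweighting with positive
  -- density, so `C₁ = 0` would force `μ = 0`.
  have hC0 : C₁ ≠ 0 := by
    rintro rfl
    obtain ⟨r, hr, hp, hbr, hrv⟩ := hric 0 fun u => le_rfl
    have h1 := hC₁ 1 b hb r hr hp hbr 0 hrv
    rw [ENNReal.coe_zero, zero_mul, zero_mul] at h1
    refine h0 (reweight_univ_eq_zero (σ := σ) (αsq := αsq) (βsq := -b ^ 2) ?_)
    rw [← h1, ← laplaceFunctional_one_zero (2 / σ ^ 2)]
    congr 1
  refine ⟨C₂ / C₁, ?_⟩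
  have hreg₁ := hμ.orbital.radon.innerRegular
  refine eq_of_laplaceFunctional_withDensity_eq (c := 2 * (-b ^ 2 - αsq) / σ ^ 2) hs
    hν.orbital.radon.innerRegular inferInstance (hfin₂ b ((le_max_right _ _).trans hb.le))
    fun g v hv => ?_
  obtain ⟨r, hr, hp, hbr, hrv⟩ := hric v hv
  change laplaceFunctional (2 / σ ^ 2) (reweight σ αsq (-b ^ 2) ν) _ _
    = laplaceFunctional (2 / σ ^ 2) (reweight σ αsq (-b ^ 2) ((C₂ / C₁) • μ)) _ _
  rw [reweight_smul, laplaceFunctional_smul_measure, hC₁ g b hb r hr hp hbr v hrv,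
    hC₂ g b hb r hr hp hbr v hrv, ← mul_assoc, ← mul_assoc, ← ENNReal.coe_mul,
    div_mul_cancel₀ _ hC0]

/-! ### Translation invariance -/

theorem energy_translate (τ₀ : UnitAddCircle) (φ : CircleDiffeo 1) :
    (CircleDiffeo.translate τ₀ φ).energy = φ.energy := by
  rw [energy_eq, energy_eq, speed_translate]

theorem laplaceFunctional_reweight_map_translate (s βsq : ℝ) (τ₀ : UnitAddCircle)
    (g : C(UnitAddCircle, ℝ≥0)) (v : C(UnitAddCircle, ℝ)) :
    laplaceFunctional s (reweight σ αsq βsq (μ.map (CircleDiffeo.translate τ₀))) (fun u => g u) v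
      = laplaceFunctional s (reweight σ αsq βsq μ)
        (fun u => (g.comp ⟨fun u => u - τ₀, by fun_prop⟩ : C(UnitAddCircle, ℝ≥0)) u) v := by
  have hm : ∀ g : C(UnitAddCircle, ℝ≥0), Measurable fun φ : CircleDiffeo 1 =>
      (g (φ.toHomeomorph.symm 0) : ℝ≥0∞) * ENNReal.ofReal (Real.exp (-s * speedPairing v φ)) :=
    fun g => measurable_weight g
      (continuous_const.mul (continuous_speedPairing v.continuous)).measurable
  have hρ := measurable_exp_energy (2 * (βsq - αsq) / σ ^ 2)
  rw [laplaceFunctional, laplaceFunctional, reweight, reweight,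
    lintegral_withDensity_eq_lintegral_mul _ hρ (hm _),
    lintegral_withDensity_eq_lintegral_mul _ hρ (hm _),
    lintegral_map (hρ.mul (hm _)) (continuous_translate τ₀).measurable]
  refine lintegral_congr fun φ => ?_
  simp only [Pi.mul_apply, energy_translate, symm_translate, speedPairing, speed_translate]
  rfl

/-- Translation keeps the speed and shifts the root by `-τ₀`, while the explicit Laplace functional
sees `g` only through its Haar integral. The two functionals are compared directly, so the
translated measure need not first be shown to be orbital. -/
theorem IsRegularOrbitalMeasure.map_translate (hσ : 0 < σ) (hμ : IsRegularOrbitalMeasure σ αsq μ)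
    (τ₀ : UnitAddCircle) : μ.map (CircleDiffeo.translate τ₀) = μ := by
  have hs : 0 < 2 / σ ^ 2 := by positivity
  obtain ⟨b₀, hb₀, hfin⟩ := hμ.exists_forall_finite
  obtain ⟨C, hC⟩ := hμ.orbital.exists_laplaceFunctional_eq hσ hb₀ (hfin b₀ le_rfl)
  set b := b₀ + 1
  have hb : b₀ < b := lt_add_one b₀
  have hreg := hμ.orbital.radon.innerRegular
  refine (eq_of_laplaceFunctional_withDensity_eq (c := 2 * (-b ^ 2 - αsq) / σ ^ 2) hs hreg
    (Measure.InnerRegular.map_of_continuous (continuous_translate τ₀))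
    (hfin b hb.le) fun g v hv => ?_).symm
  change laplaceFunctional (2 / σ ^ 2) (reweight σ αsq (-b ^ 2) μ) _ _
    = laplaceFunctional (2 / σ ^ 2) (reweight σ αsq (-b ^ 2) (μ.map (CircleDiffeo.translate τ₀))) _ _
  obtain ⟨r, hr, hp, hbr, hrv⟩ := exists_riccati (ContinuousMap.const _ (b ^ 2) + v)
    (hb₀.trans hb) fun u => le_add_of_nonneg_right (hv u)
  rw [laplaceFunctional_reweight_map_translate, hC g b hb r hr hp hbr v hrv,
    hC _ b hb r hr hp hbr v hrv]
  congr 2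
  exact (lintegral_sub_right_eq_self (fun u => (g u : ℝ≥0∞)) τ₀).symm

end

end

theorem mainTheorem2 (σ : ℝ) (hσ : 0 < σ) (αsq : ℝ) :
    (∀ μ ν : Measure (CircleDiffeo 1), IsRegularOrbitalMeasure σ αsq μ →
      IsRegularOrbitalMeasure σ αsq ν → μ ≠ 0 → ∃ c : ℝ≥0, ν = c • μ) ∧
    (∀ μ : Measure (CircleDiffeo 1), IsRegularOrbitalMeasure σ αsq μ →
      ∀ τ₀ : UnitAddCircle, MeasurePreserving (CircleDiffeo.translate τ₀) μ μ) :=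
  ⟨fun _ _ hμ hν h0 => hμ.unique hσ hν h0, fun _ hμ τ₀ =>
    ⟨(CircleDiffeo.continuous_translate τ₀).measurable, hμ.map_translate hσ τ₀⟩⟩
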